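/- Let $(X,\mu)$ be a standard Lebesgue probability space and let $G$ be the group of its automorphisms (invertible measure-preserving transformations, identified when they agree almost everywhere); transformations are identified with the corresponding unitary operators on $L^2(X,\mu)$, and $I$ is the identity. For $T\in G$ put $$H(T)=\{S\in G: T^{-n}ST^n\to I\ (n\to\infty)\},\qquad WH(T)=\Big\{S\in G:\ \frac1N\sum_{n=1}^N T^{-n}ST^n\to I\ (N\to\infty)\Big\},$$ with convergence in the strong operator topology on $L^2(X,\mu)$. For $\beta>0$ we say that $T$ admits $\beta$-towers if there is a sequence of countable measurable partitions $\xi_j=\{B_j,TB_j,\dots,T^{h_j-1}B_j,C_j^1,C_j^2,\dots\}$ of $X$ such that every measurable set $A$ is approximated by $\xi_j$-measurable sets $E_j$, i.e. $\mu(E_j\triangle A)\to0$, and $\mu\big(\bigsqcup_{0\le k<h_j}T^kB_j\big)\to\beta$. The local rank $\beta(T)$ is the maximal $\beta$ for which $T$ admits $\beta$-towers, and $T$ has rank 1 if $\beta(T)=1$. A Markov operator on $L^2(X,\mu)$ is a positive bounded operator $M$ with $M1=1$ and $M^*1=1$. Theorem 3. (1) If $T$ has rank 1 and $WH(T)$ is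 infinite, then $T$ is rigid: $T^{n_i}\to I$ strongly for some sequence $n_i\to\infty$. (2) If $R$ is mixing and of rank 1, then $H(R)=WH(R)=\{I\}$. (3) If $T$ is ergodic, $\beta(T)=\beta>0$ and $WH(T)$ is infinite, then there are a sequence $n_i\to\infty$ and a Markov operator $M$ such that $T^{n_i}\to\beta I+(1-\beta)M$ in the weak operator topology on $L^2(X,\mu)$ ($T$ is partially rigid). -/

import Mathlib

open MeasureTheory Filter Topology
open scoped symmDiff ENNReal

noncomputable section

/-- The pointwise invertible, bimeasurable, measure-preserving transformations of `(X, μ)`. -/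
def MPAut {X : Type*} [MeasurableSpace X] (μ : Measure X) : Subgroup (Equiv.Perm X) where
  carrier := {e | MeasurePreserving e μ μ ∧ MeasurePreserving e.symm μ μ}
  one_mem' := ⟨MeasurePreserving.id μ, MeasurePreserving.id μ⟩
  mul_mem' := fun ha hb => ⟨ha.1.comp hb.1, hb.2.comp ha.2⟩
  inv_mem' := fun ha => ⟨ha.2, ha.1⟩

/-- The transformations that coincide with the identity almost everywhere. -/
def nullAut {X : Type*} [MeasurableSpace X] (μ : Measure X) : Subgroup (MPAut μ) where
  carrier := {e | ⇑(e : Equiv.Perm X) =ᵐ[μ] id}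
  one_mem' := ae_of_all μ fun _ => rfl
  mul_mem' := fun {a b} ha hb => by
    have h1 : (⇑(a : Equiv.Perm X) ∘ ⇑(b : Equiv.Perm X)) =ᵐ[μ] id ∘ ⇑(b : Equiv.Perm X) :=
      b.2.1.quasiMeasurePreserving.ae_eq_comp ha
    exact h1.trans hb
  inv_mem' := fun {a} ha => by
    have h1 : (⇑(a : Equiv.Perm X) ∘ ⇑(a : Equiv.Perm X).symm) =ᵐ[μ]
        id ∘ ⇑(a : Equiv.Perm X).symm := a.2.2.quasiMeasurePreserving.ae_eq_comp ha
    have h2 : id ∘ ⇑(a : Equiv.Perm X).symm =ᵐ[μ] id :=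
      h1.symm.trans (ae_of_all μ fun x => (a : Equiv.Perm X).apply_symm_apply x)
    exact h2

instance nullAut_normal {X : Type*} [MeasurableSpace X] (μ : Measure X) :
    (nullAut μ).Normal where
  conj_mem := fun n hn g => by
    have h0 : ⇑(n : Equiv.Perm X) =ᵐ[μ] id := hn
    have h1 : (⇑(g : Equiv.Perm X) ∘ ⇑(n : Equiv.Perm X)) ∘ ⇑(g : Equiv.Perm X).symm =ᵐ[μ]
        (⇑(g : Equiv.Perm X) ∘ id) ∘ ⇑(g : Equiv.Perm X).symm :=
      g.2.2.quasiMeasurePreserving.ae_eq_comp (h0.fun_comp ⇑(g : Equiv.Perm X))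
    have h2 : (⇑(g : Equiv.Perm X) ∘ ⇑(n : Equiv.Perm X)) ∘ ⇑(g : Equiv.Perm X).symm =ᵐ[μ] id :=
      h1.trans (ae_of_all μ fun x => (g : Equiv.Perm X).apply_symm_apply x)
    exact h2

/-- The group of all automorphisms of `(X, μ)`: measure-preserving invertible transformations,
two of them being identified when they agree almost everywhere. -/
abbrev AutGroup {X : Type*} [MeasurableSpace X] (μ : Measure X) : Type _ :=
  MPAut μ ⧸ nullAut μ

/-- The operator `f ↦ f ∘ g⁻¹` on `L²(X, μ)`, for a pointwise transformation `g`. -/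
def preKoopman {X : Type*} [MeasurableSpace X] (μ : Measure X) :
    MPAut μ →* (Lp ℝ 2 μ →L[ℝ] Lp ℝ 2 μ) where
  toFun g := (Lp.compMeasurePreservingₗᵢ ℝ (g : Equiv.Perm X).symm g.2.2).toContinuousLinearMap
  map_one' := by
    ext1 f
    exact Lp.compMeasurePreserving_id_apply f
  map_mul' := fun a b => by
    ext1 f
    exact Lp.compMeasurePreserving_comp_apply f b.2.2 a.2.2

/-- The unitary operator `f ↦ f ∘ g⁻¹` on `L²(X, μ)` associated with an automorphism `g`. -/
def koopman {X : Type*} [MeasurableSpace X] (μ : Measure X) :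
    AutGroup μ →* (Lp ℝ 2 μ →L[ℝ] Lp ℝ 2 μ) :=
  QuotientGroup.lift (nullAut μ) (preKoopman μ) (fun g hg => by
    ext1 f
    refine Lp.ext ?_
    have hg' : ⇑(g : Equiv.Perm X).symm =ᵐ[μ] id := (nullAut μ).inv_mem hg
    refine (Lp.coeFn_compMeasurePreserving f g.2.2).trans ?_
    exact Filter.EventuallyEq.fun_comp hg' f)

/-- The homoclinic group `{S : T⁻ⁿ S Tⁿ → I}`, with strong operator convergence on `L²`. -/
def homoclinic {X : Type*} [MeasurableSpace X] {μ : Measure X} (T : AutGroup μ) :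
    Set (AutGroup μ) :=
  {S | ∀ f : Lp ℝ 2 μ,
    Tendsto (fun n : ℕ => koopman μ ((T ^ n)⁻¹ * S * T ^ n) f) atTop (𝓝 f)}

/-- The weak homoclinic group `{S : N⁻¹ ∑_{n=1}^N T⁻ⁿ S Tⁿ → I}`, with strong operator
convergence on `L²`. -/
def weakHomoclinic {X : Type*} [MeasurableSpace X] {μ : Measure X} (T : AutGroup μ) :
    Set (AutGroup μ) :=
  {S | ∀ f : Lp ℝ 2 μ,
    Tendsto (fun N : ℕ => (N : ℝ)⁻¹ •
      ∑ n ∈ Finset.Icc 1 N, koopman μ ((T ^ n)⁻¹ * S * T ^ n) f) atTop (𝓝 f)}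

/-- A countable measurable partition of `X` of the form
`{B, TB, …, T^{h-1}B, C 0, C 1, …}`; some of the sets may be empty. -/
structure TowerPartition {X : Type*} [MeasurableSpace X] (T : Equiv.Perm X) where
  base : Set X
  height : ℕ
  rest : ℕ → Set X
  base_meas : MeasurableSet base
  rest_meas : ∀ i, MeasurableSet (rest i)
  disj : Pairwise (Function.onFun Disjoint
    (Sum.elim (fun k : Fin height => T^[(k : ℕ)] '' base) rest))
  cover : (⋃ i, Sum.elim (fun k : Fin height => T^[(k : ℕ)] '' base) rest i) = Set.univ

/-- The elements of the partition. -/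
def TowerPartition.cell {X : Type*} [MeasurableSpace X] {T : Equiv.Perm X}
    (ξ : TowerPartition T) : Fin ξ.height ⊕ ℕ → Set X :=
  Sum.elim (fun k => T^[(k : ℕ)] '' ξ.base) ξ.rest

/-- The tower `B ⊔ TB ⊔ … ⊔ T^{h-1}B`. -/
def TowerPartition.tower {X : Type*} [MeasurableSpace X] {T : Equiv.Perm X}
    (ξ : TowerPartition T) : Set X :=
  ⋃ k : Fin ξ.height, T^[(k : ℕ)] '' ξ.base

/-- `E` is measurable with respect to the partition: a union of some of its elements. -/
def TowerPartition.Saturated {X : Type*} [MeasurableSpace X] {T : Equiv.Perm X}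
    (ξ : TowerPartition T) (E : Set X) : Prop :=
  ∃ I : Set (Fin ξ.height ⊕ ℕ), E = ⋃ i ∈ I, ξ.cell i

/-- There is a sequence of tower partitions that approximates every measurable set and whose
towers have measures tending to `β > 0`. -/
def HasTowers {X : Type*} [MeasurableSpace X] (μ : Measure X) (T : Equiv.Perm X) (β : ℝ) : Prop :=
  0 < β ∧ ∃ ξ : ℕ → TowerPartition T,
    (∀ A : Set X, MeasurableSet A → ∃ E : ℕ → Set X, (∀ j, (ξ j).Saturated (E j)) ∧
      Tendsto (fun j => μ (E j ∆ A)) atTop (𝓝 0)) ∧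
    Tendsto (fun j => μ (ξ j).tower) atTop (𝓝 (ENNReal.ofReal β))

/-- The local rank of `T` equals `β > 0`: `β` is the maximal number with approximating towers. -/
def HasLocalRank {X : Type*} [MeasurableSpace X] (μ : Measure X) (T : Equiv.Perm X) (β : ℝ) :
    Prop :=
  IsGreatest {b : ℝ | HasTowers μ T b} β

/-- `T` is of rank one: its local rank is `1`. -/
def RankOne {X : Type*} [MeasurableSpace X] (μ : Measure X) (T : Equiv.Perm X) : Prop :=
  HasLocalRank μ T 1

/-- `T` is mixing: `μ(T⁻ⁿA ∩ B) → μ(A) μ(B)`. -/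
def IsMixing {X : Type*} [MeasurableSpace X] (μ : Measure X) (T : Equiv.Perm X) : Prop :=
  ∀ A B : Set X, MeasurableSet A → MeasurableSet B →
    Tendsto (fun n : ℕ => μ ((T^[n] ⁻¹' A) ∩ B)) atTop (𝓝 (μ A * μ B))

/-- `T` is rigid: `T^{n_i} → I` strongly on `L²` for some sequence `n_i → ∞`. -/
def IsRigid {X : Type*} [MeasurableSpace X] {μ : Measure X} (T : AutGroup μ) : Prop :=
  ∃ n : ℕ → ℕ, Tendsto n atTop atTop ∧
    ∀ f : Lp ℝ 2 μ, Tendsto (fun i => koopman μ (T ^ n i) f) atTop (𝓝 f)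

/-- `M` is a Markov operator on `L²(X, μ)`: it is positive, `M 1 = 1`, and it preserves the
integral, that is `M* 1 = 1`. -/
structure IsMarkovOperator {X : Type*} [MeasurableSpace X] (μ : Measure X) [IsFiniteMeasure μ]
    (M : Lp ℝ 2 μ →L[ℝ] Lp ℝ 2 μ) : Prop where
  nonneg : ∀ f : Lp ℝ 2 μ, 0 ≤ f → 0 ≤ M f
  map_one : M (Lp.const 2 μ (1 : ℝ)) = Lp.const 2 μ (1 : ℝ)
  integral_eq : ∀ f : Lp ℝ 2 μ, ∫ x, M f x ∂μ = ∫ x, f x ∂μ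

/-- `T^{n_i} → β I + (1 - β) M` in the weak operator topology of `L²`, for some sequence
`n_i → ∞` and some Markov operator `M`. -/
def IsPartiallyRigid {X : Type*} [MeasurableSpace X] {μ : Measure X} [IsFiniteMeasure μ]
    (T : AutGroup μ) (β : ℝ) : Prop :=
  ∃ n : ℕ → ℕ, Tendsto n atTop atTop ∧ ∃ M : Lp ℝ 2 μ →L[ℝ] Lp ℝ 2 μ, IsMarkovOperator μ M ∧
    ∀ f g : Lp ℝ 2 μ, Tendsto (fun i => inner ℝ (koopman μ (T ^ n i) f) g) atTop
      (𝓝 (inner ℝ (β • f + (1 - β) • M f) g))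

end

/-!
Let `S ≠ 1` be weakly homoclinic for `T`. Since the operators `T⁻ⁿSTⁿ` are unitary, convergence of
their averages to `I` means that `T⁻ⁿy` and `T⁻ⁿSy` lie on the same side of every fixed measurable
set for most `n`, in the mean over `y` (`statAsymptotic_of_mem_weakHomoclinic`). The conjugates
`T⁻ᵏSTᵏ` inherit this property, and for every `K` one finds `K` of them that have pairwise
distinct values on a set `Y` of positive measure (`measure_ne_zero_separated_pairwise`): by mean
recurrence `T⁻ᵏSTᵏ` moves points of `Y` for many `k`, while it seldom moves them far.

Consider towers of height `h` whose partitions approximate all measurable sets and whose measure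
is near `β`. When `T` is ergodic and there are no atoms, the top `1/q`-part of the tower is
asymptotically independent of every set (`Ergodic.tendsto_measureReal_inter`), so if `K` is large
compared with `q/β`, two of the `K` images of some `y ∈ Y` lie in it. They are distinct points,
hence lie in different levels `p` and `p + m` (`TowerPartition.Approximates.tendsto_sameLevel`).
Going back in time from these two points, down the first `h - h/q` levels, one sees the same sets
most of the time; as the sets are almost unions of levels, they are almost invariant under the
shift by `m` inside the tower. Thus `μ(T⁻ᵐA ∩ B) ≥ β μ(A ∩ B) - ε` for finitely many prescribed
sets at once (`exists_shift_of_statAsymptotic`). If `T` is not periodic, adding to the prescribed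
sets some that are disjoint from their preimages under `T, …, Tᵏ` forces `m > k`. If `T` is
periodic, as it is when there are atoms (`Ergodic.exists_pow_eq_one_of_atom`), its powers return
to `I` anyway.

A limit point `P` of the operators `Tᵐ` in the weak operator topology therefore dominates `β I`,
and `P = β I + (1 - β) M` with `M` Markov (`exists_isMarkovOperator`). For `β = 1` the limit is
`I`, and weak convergence of isometries to `I` is strong. A rank-one transformation is ergodic
(`RankOne.ergodic`), and a mixing transformation of a nontrivial space is not rigid.
-/

/-! ### Automorphisms and their unitary operators; statistical asymptotics -/

section

variable {X : Type*} [MeasurableSpace X] {μ : Measure X}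

theorem MPAut.measurePreserving (g : MPAut μ) : MeasurePreserving g.1 μ μ := g.2.1

theorem MPAut.measurable (g : MPAut μ) : Measurable g.1 := g.2.1.measurable

theorem MPAut.measureReal_preimage (g : MPAut μ) {A : Set X} (hA : MeasurableSet A) :
    μ.real (g.1 ⁻¹' A) = μ.real A :=
  g.2.1.measureReal_preimage hA.nullMeasurableSet

theorem MPAut.coe_pow (g : MPAut μ) (n : ℕ) : ⇑(g ^ n).1 = (g.1)^[n] := by
  rw [SubgroupClass.coe_pow, Equiv.Perm.iterate_eq_pow]

theorem MPAut.mk_eq_one_iff (g : MPAut μ) :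
    (g : AutGroup μ) = 1 ↔ ∀ᵐ x ∂μ, g.1 x = x :=
  QuotientGroup.eq_one_iff g

/-- The indicator function of `A` as an element of `L²`. -/
noncomputable abbrev indL2 (μ : Measure X) [IsFiniteMeasure μ] {A : Set X}
    (hA : MeasurableSet A) : Lp ℝ 2 μ :=
  indicatorConstLp 2 hA (measure_ne_top μ A) (1 : ℝ)

theorem inner_indL2 [IsFiniteMeasure μ] {A B : Set X} (hA : MeasurableSet A)
    (hB : MeasurableSet B) : inner ℝ (indL2 μ hA) (indL2 μ hB) = μ.real (A ∩ B) :=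
  L2.real_inner_indicatorConstLp_one_indicatorConstLp_one hA hB

theorem koopman_mk_apply (g : MPAut μ) (f : Lp ℝ 2 μ) :
    koopman μ (g : AutGroup μ) f = Lp.compMeasurePreserving g.1.symm g.2.2 f := rfl

theorem koopman_indL2 [IsFiniteMeasure μ] (g : MPAut μ) {A : Set X} (hA : MeasurableSet A) :
    koopman μ (g : AutGroup μ) (indL2 μ hA) = indL2 μ (MPAut.measurable g⁻¹ hA) := by
  rw [koopman_mk_apply]
  exact Lp.indicatorConstLp_compMeasurePreserving hA (measure_ne_top μ A) 1 g.2.2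

theorem norm_koopman (g : AutGroup μ) (f : Lp ℝ 2 μ) : ‖koopman μ g f‖ = ‖f‖ := by
  induction g using QuotientGroup.induction_on with
  | H g => rw [koopman_mk_apply, Lp.norm_compMeasurePreserving]

theorem measureReal_symmDiff_eq_sub [IsFiniteMeasure μ] {A B : Set X} (hA : MeasurableSet A)
    (hB : MeasurableSet B) :
    μ.real (A ∆ B) = μ.real A + μ.real B - 2 * μ.real (A ∩ B) := by
  rw [measureReal_symmDiff_eq hA hB]
  have h1 := measureReal_inter_add_sdiff (μ := μ) (s := A) hB
  have h2 := measureReal_inter_add_sdiff (μ := μ) (s := B) hA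
  rw [Set.inter_comm B A] at h2
  linarith

/-- For almost every `y`, the points `y` and `S y` have statistically the same past: the
proportion of the times `n ≤ N` at which `A` separates `T⁻ⁿ y` from `T⁻ⁿ S y` tends to zero
in mean, for each measurable set `A`. -/
def StatAsymptotic (T S : MPAut μ) : Prop :=
  ∀ A : Set X, MeasurableSet A → Tendsto (fun N : ℕ => (N : ℝ)⁻¹ * ∑ n ∈ Finset.Icc 1 N,
    μ.real ((((T ^ n)⁻¹ * S).1 ⁻¹' A) ∆ (((T ^ n)⁻¹).1 ⁻¹' A))) atTop (𝓝 0)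

/-- The `n`-th measure in `StatAsymptotic` is `2 μ(A) - 2 ⟪Vₙ 1_A, 1_A⟫`, where `Vₙ` is the operator
of `T⁻ⁿSTⁿ`, so strong convergence of the averages of `Vₙ` makes its averages tend to zero. -/
theorem statAsymptotic_of_mem_weakHomoclinic [IsProbabilityMeasure μ] {T S : MPAut μ}
    (hS : (S : AutGroup μ) ∈ weakHomoclinic (T : AutGroup μ)) : StatAsymptotic T S := by
  intro A hA
  set g : ℕ → MPAut μ := fun n => (T ^ n)⁻¹ * S * T ^ n with hg
  have key : ∀ n, μ.real ((((T ^ n)⁻¹ * S).1 ⁻¹' A) ∆ (((T ^ n)⁻¹).1 ⁻¹' A)) =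
      2 * μ.real A - 2 * inner ℝ (koopman μ (g n : AutGroup μ) (indL2 μ hA)) (indL2 μ hA) := by
    intro n
    rw [koopman_indL2, inner_indL2]
    have h1 : ((S⁻¹ * T ^ n).1 ⁻¹' ((((T ^ n)⁻¹ * S).1 ⁻¹' A) ∆ (((T ^ n)⁻¹).1 ⁻¹' A))) =
        A ∆ ((g n)⁻¹.1 ⁻¹' A) := by
      have e1 : (T ^ n)⁻¹ * S * (S⁻¹ * T ^ n) = 1 := by group
      have e2 : (T ^ n)⁻¹ * (S⁻¹ * T ^ n) = (g n)⁻¹ := by simp only [hg]; group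
      have e3 : (S⁻¹ * T ^ n).1 ⁻¹' (((T ^ n)⁻¹ * S).1 ⁻¹' A) =
          ((T ^ n)⁻¹ * S * (S⁻¹ * T ^ n)).1 ⁻¹' A := rfl
      have e4 : (S⁻¹ * T ^ n).1 ⁻¹' (((T ^ n)⁻¹).1 ⁻¹' A) =
          ((T ^ n)⁻¹ * (S⁻¹ * T ^ n)).1 ⁻¹' A := rfl
      rw [Set.preimage_symmDiff, e3, e4, e1, e2]
      rfl
    have hm1 := MPAut.measurable ((T ^ n)⁻¹ * S) hA
    have hm2 := MPAut.measurable (T ^ n)⁻¹ hA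
    rw [← MPAut.measureReal_preimage (S⁻¹ * T ^ n) (hm1.symmDiff hm2), h1,
      measureReal_symmDiff_eq_sub hA (MPAut.measurable (g n)⁻¹ hA),
      MPAut.measureReal_preimage (g n)⁻¹ hA,
      Set.inter_comm]
    ring
  have h := ((hS (indL2 μ hA)).inner (𝕜 := ℝ) (tendsto_const_nhds (x := indL2 μ hA))).const_mul
    (2 : ℝ)
  rw [inner_indL2, Set.inter_self] at h
  have h2 := h.const_sub (2 * μ.real A)
  rw [sub_self] at h2
  refine h2.congr' ?_
  filter_upwards [eventually_gt_atTop 0] with N hN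
  have hN' : (N : ℝ) ≠ 0 := by positivity
  simp_rw [key]
  rw [Finset.sum_sub_distrib, Finset.sum_const, Nat.card_Icc, real_inner_smul_left, sum_inner,
    ← Finset.mul_sum, nsmul_eq_mul, Nat.add_sub_cancel, mul_sub, inv_mul_cancel_left₀ hN']
  rw [mul_left_comm]
  rfl

/-- Conjugation by `Tᵏ` shifts the times by `k`. -/
theorem StatAsymptotic.conj [IsProbabilityMeasure μ] {T S : MPAut μ} (hS : StatAsymptotic T S)
    (k : ℕ) : StatAsymptotic T ((T ^ k)⁻¹ * S * T ^ k) := by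
  intro A hA
  set u : ℕ → ℝ := fun n => μ.real ((((T ^ n)⁻¹ * S).1 ⁻¹' A) ∆ (((T ^ n)⁻¹).1 ⁻¹' A)) with hu
  have key : ∀ n, μ.real ((((T ^ n)⁻¹ * ((T ^ k)⁻¹ * S * T ^ k)).1 ⁻¹' A) ∆
      (((T ^ n)⁻¹).1 ⁻¹' A)) = u (n + k) := by
    intro n
    have hm1 := MPAut.measurable ((T ^ n)⁻¹ * ((T ^ k)⁻¹ * S * T ^ k)) hA
    have hm2 := MPAut.measurable (T ^ n)⁻¹ hA
    rw [← MPAut.measureReal_preimage (T ^ k)⁻¹ (hm1.symmDiff hm2), Set.preimage_symmDiff]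
    have e1 : (T ^ n)⁻¹ * ((T ^ k)⁻¹ * S * T ^ k) * (T ^ k)⁻¹ = (T ^ (n + k))⁻¹ * S := by
      rw [add_comm, pow_add]; group
    have e2 : (T ^ n)⁻¹ * (T ^ k)⁻¹ = (T ^ (n + k))⁻¹ := by
      rw [add_comm, pow_add]; group
    rw [hu]
    simp only
    rw [← e1, ← e2]
    rfl
  have hu0 : ∀ n, 0 ≤ u n := fun n => measureReal_nonneg
  have h := hS A hA
  have h1 : Tendsto (fun N : ℕ => ((N + k : ℕ) : ℝ)⁻¹ * ∑ n ∈ Finset.Icc 1 (N + k), u n)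
      atTop (𝓝 0) := h.comp (tendsto_add_atTop_nat k)
  have h2 : Tendsto (fun N : ℕ => (1 + (k : ℝ) / (N : ℝ)) *
      (((N + k : ℕ) : ℝ)⁻¹ * ∑ n ∈ Finset.Icc 1 (N + k), u n)) atTop (𝓝 0) := by
    have := ((tendsto_const_div_atTop_nhds_zero_nat (k : ℝ)).const_add 1).mul h1
    simpa using this
  refine squeeze_zero' (Eventually.of_forall fun N => by positivity) ?_ h2
  filter_upwards [eventually_gt_atTop 0] with N hN
  have hN' : (N : ℝ) ≠ 0 := by positivity
  have hNk : ((N : ℝ) + k) ≠ 0 := by positivity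
  simp_rw [key]
  have e : (1 + (k : ℝ) / (N : ℝ)) * (((N + k : ℕ) : ℝ)⁻¹ * ∑ n ∈ Finset.Icc 1 (N + k), u n) =
      (N : ℝ)⁻¹ * ∑ n ∈ Finset.Icc 1 (N + k), u n := by
    push_cast
    field_simp
  rw [e]
  refine mul_le_mul_of_nonneg_left ?_ (by positivity)
  have : ∑ n ∈ Finset.Icc 1 N, u (n + k) = ∑ n ∈ Finset.Icc (1 + k) (N + k), u n := by
    rw [← Finset.map_add_right_Icc, Finset.sum_map]
    rfl
  rw [this]
  exact Finset.sum_le_sum_of_subset_of_nonneg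
    (Finset.Icc_subset_Icc_left (by omega)) fun i _ _ => hu0 i

end

/-! ### Separation of points, recurrence, and distinct images under conjugates -/

section

variable {X : Type*} [MeasurableSpace X] {μ : Measure X}

/-- If two maps differ on a set of positive measure, a single measurable set separates their values
on a part of positive measure. -/
theorem exists_measure_separated_ne_zero [MeasurableSpace.CountablySeparated X] {Ω : Type*}
    [MeasurableSpace Ω] {P : Measure Ω} {a b : Ω → X} {Y : Set Ω} (hY : P Y ≠ 0)
    (hab : ∀ y ∈ Y, a y ≠ b y) :
    ∃ C : Set X, MeasurableSet C ∧ P (Y ∩ (a ⁻¹' C ∩ b ⁻¹' Cᶜ)) ≠ 0 := by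
  by_contra! hcon
  obtain ⟨C, hC, hsep⟩ := exists_seq_separating X (p := MeasurableSet) MeasurableSet.empty Set.univ
  refine hY (measure_mono_null (t := ⋃ n, (Y ∩ (a ⁻¹' C n ∩ b ⁻¹' (C n)ᶜ)) ∪
    (Y ∩ (a ⁻¹' (C n)ᶜ ∩ b ⁻¹' (C n)ᶜᶜ))) ?_ (measure_iUnion_null fun n =>
      measure_union_null (hcon _ (hC n)) (hcon _ (hC n).compl)))
  intro y hy
  have h : ¬ ∀ n, a y ∈ C n ↔ b y ∈ C n := fun h => hab y hy (hsep _ trivial _ trivial h)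
  push Not at h
  obtain ⟨n, hn⟩ := h
  rw [Set.mem_iUnion]
  refine ⟨n, ?_⟩
  rcases hn with ⟨h1, h2⟩ | ⟨h1, h2⟩
  · exact Or.inl ⟨hy, h1, h2⟩
  · exact Or.inr ⟨hy, h1, fun h => h h2⟩

theorem koopman_inv_indL2 [IsFiniteMeasure μ] (g : MPAut μ) {A : Set X} (hA : MeasurableSet A) :
    koopman μ ((g⁻¹ : MPAut μ) : AutGroup μ) (indL2 μ hA) = indL2 μ (MPAut.measurable g hA) :=
  koopman_indL2 g⁻¹ hA

theorem inner_koopman_koopman (g : AutGroup μ) (f h : Lp ℝ 2 μ) :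
    inner ℝ (koopman μ g f) (koopman μ g h) = inner ℝ f h :=
  (LinearIsometry.mk (koopman μ g : Lp ℝ 2 μ →ₗ[ℝ] Lp ℝ 2 μ) (norm_koopman g)).inner_map_map f h

theorem sum_Icc_one {M : Type*} [AddCommMonoid M] (f : ℕ → M) (N : ℕ) :
    ∑ n ∈ Finset.Icc 1 N, f n = ∑ n ∈ Finset.range N, f (n + 1) := by
  induction N with
  | zero => rfl
  | succ N ih => rw [Finset.sum_Icc_succ_top (by omega), ih, Finset.sum_range_succ]

/-- The mean ergodic theorem for the indicator function of a set. -/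
theorem exists_tendsto_average_indL2 [IsFiniteMeasure μ] (T : MPAut μ) {A : Set X}
    (hA : MeasurableSet A) : ∃ φ : Lp ℝ 2 μ,
      koopman μ ((T⁻¹ : MPAut μ) : AutGroup μ) φ = φ ∧
      Tendsto (fun N : ℕ => (N : ℝ)⁻¹ • ∑ n ∈ Finset.Icc 1 N,
        indL2 μ (MPAut.measurable (T ^ n) hA)) atTop (𝓝 φ) := by
  set U := koopman μ ((T⁻¹ : MPAut μ) : AutGroup μ) with hU
  have hnorm : ‖U‖ ≤ 1 := U.opNorm_le_bound zero_le_one fun f => by rw [norm_koopman, one_mul]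
  have h := U.tendsto_birkhoffAverage_orthogonalProjection hnorm (indL2 μ hA)
  set φ := (U.eqLocus (1 : Lp ℝ 2 μ →L[ℝ] Lp ℝ 2 μ)).orthogonalProjectionOnto (indL2 μ hA)
  have hφ : U (φ : Lp ℝ 2 μ) = φ := φ.2
  refine ⟨φ, hφ, ?_⟩
  have h2 := (U.continuous.tendsto _).comp h
  rw [hφ] at h2
  refine h2.congr fun N => ?_
  have hpow : ∀ n, U^[n] (indL2 μ hA) = indL2 μ (MPAut.measurable (T ^ n) hA) := by
    intro n
    induction n with
    | zero => rfl
    | succ n ih =>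
      rw [Function.iterate_succ_apply', ih, hU, koopman_inv_indL2]
      rfl
  simp only [Function.comp, birkhoffAverage, birkhoffSum, map_smul, map_sum, _root_.id]
  rw [sum_Icc_one]
  congr 1
  refine Finset.sum_congr rfl fun n _ => ?_
  rw [← Function.iterate_succ_apply' (f := U), hpow]

/-- No set of positive measure returns to itself with zero mean frequency. -/
theorem not_tendsto_average_return [IsFiniteMeasure μ] (T : MPAut μ) {Y : Set X}
    (hY : MeasurableSet Y) (hpos : μ Y ≠ 0) :
    ¬ Tendsto (fun N : ℕ => (N : ℝ)⁻¹ * ∑ n ∈ Finset.Icc 1 N, μ.real ((T ^ n).1 ⁻¹' Y ∩ Y))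
      atTop (𝓝 0) := by
  intro h0
  obtain ⟨φ, hφ, hlim⟩ := exists_tendsto_average_indL2 T hY
  -- `⟪g, φ⟫` is the limit of the averages of `⟪g, 1_{T⁻ⁿ Y}⟫`, for every `g`
  have hinner : ∀ g : Lp ℝ 2 μ, Tendsto (fun N : ℕ => (N : ℝ)⁻¹ * ∑ n ∈ Finset.Icc 1 N,
      inner ℝ (indL2 μ (MPAut.measurable (T ^ n) hY)) g) atTop (𝓝 (inner ℝ φ g)) := by
    intro g
    refine (hlim.inner (𝕜 := ℝ) (tendsto_const_nhds (x := g))).congr fun N => ?_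
    rw [real_inner_smul_left, sum_inner]
  have h1 : inner ℝ φ (indL2 μ hY) = 0 := by
    refine tendsto_nhds_unique (hinner _) (h0.congr fun N => ?_)
    simp_rw [inner_indL2]
  have hav : ∀ (c : ℝ) (u : ℕ → ℝ), (∀ n, u n = c) →
      Tendsto (fun N : ℕ => (N : ℝ)⁻¹ * ∑ n ∈ Finset.Icc 1 N, u n) atTop (𝓝 c) := by
    intro c u hu
    refine tendsto_const_nhds.congr' ?_
    filter_upwards [eventually_gt_atTop 0] with N hN
    have hN' : (N : ℝ) ≠ 0 := by positivity
    simp_rw [hu]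
    rw [Finset.sum_const, Nat.card_Icc, nsmul_eq_mul, Nat.add_sub_cancel, inv_mul_cancel_left₀ hN']
  have h2 : inner ℝ φ φ = (0 : ℝ) := by
    rw [← h1]
    refine tendsto_nhds_unique (hinner φ) (hav _ _ fun n => ?_)
    have hn : koopman μ (((T ^ n)⁻¹ : MPAut μ) : AutGroup μ) φ = φ := by
      induction n with
      | zero => simp
      | succ n ih =>
        have : ((T ^ (n + 1))⁻¹ : MPAut μ) = T⁻¹ * (T ^ n)⁻¹ := by rw [pow_succ]; group
        rw [this, QuotientGroup.mk_mul, map_mul, mul_apply_eq_comp, ih, hφ]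
    conv_lhs => rw [← hn, ← koopman_inv_indL2 _ hY]
    rw [inner_koopman_koopman, real_inner_comm]
  rw [inner_self_eq_zero] at h2
  have h3 : inner ℝ φ (indL2 μ MeasurableSet.univ) = μ.real Y := by
    refine tendsto_nhds_unique (hinner _) (hav _ _ fun n => ?_)
    rw [inner_indL2, Set.inter_univ, MPAut.measureReal_preimage _ hY]
  rw [h2, inner_zero_left] at h3
  exact hpos ((measureReal_eq_zero_iff).1 h3.symm)

/-- There are arbitrarily many conjugates `T⁻ᵏSTᵏ` whose values are pairwise distinct at all
points of a set `Y` of positive measure. For the induction, `Y` lies in a set `C` that contains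
none of these values: since `T⁻ⁿSTⁿ` moves a point of `Y` whenever `Tⁿ` returns it to `Y`, but
carries it out of `C` only for few `n`, one more conjugate has its values in `C` and off the
diagonal. -/
theorem measure_ne_zero_separated_pairwise [IsProbabilityMeasure μ]
    [MeasurableSpace.CountablySeparated X] {T S : MPAut μ}
    (hS : StatAsymptotic T S) (hne : μ {x | S.1 x ≠ x} ≠ 0) (hU : MeasurableSet {x | S.1 x ≠ x})
    (K : ℕ) : ∃ (k : Fin K → ℕ) (Y C : Set X), MeasurableSet Y ∧ MeasurableSet C ∧ μ Y ≠ 0 ∧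
      (∀ y ∈ Y, S.1 y ≠ y) ∧ Y ⊆ C ∧
      (∀ y ∈ Y, ∀ i, ((T ^ k i)⁻¹ * S * T ^ k i).1 y ∉ C) ∧
      (∀ y ∈ Y, Pairwise fun i j => ((T ^ k i)⁻¹ * S * T ^ k i).1 y ≠
        ((T ^ k j)⁻¹ * S * T ^ k j).1 y) := by
  induction K with
  | zero =>
    exact ⟨Fin.elim0, {x | S.1 x ≠ x}, Set.univ, hU, MeasurableSet.univ, hne, fun y hy => hy,
      Set.subset_univ _, fun _ _ i => i.elim0, fun _ _ i => i.elim0⟩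
  | succ K ih =>
    obtain ⟨k, Y, C, hYm, hCm, hY0, hYU, hYC, hout, hpair⟩ := ih
    set g : ℕ → MPAut μ := fun n => (T ^ n)⁻¹ * S * T ^ n with hg
    -- some conjugate of `S` moves a substantial part of `Y` without leaving `C`
    obtain ⟨n, hn⟩ : ∃ n, μ ((T ^ n).1 ⁻¹' Y ∩ Y ∩ (g n).1 ⁻¹' C) ≠ 0 := by
      by_contra! hcon
      refine not_tendsto_average_return T hYm hY0 (squeeze_zero (fun N => by positivity)
        (fun N => mul_le_mul_of_nonneg_left (Finset.sum_le_sum fun n _ => ?_) (by positivity))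
        (hS C hCm))
      have hm1 := MPAut.measurable ((T ^ n)⁻¹ * S) hCm
      have hm2 := MPAut.measurable (T ^ n)⁻¹ hCm
      rw [← MPAut.measureReal_preimage (T ^ n) (hm1.symmDiff hm2)]
      have hsub : (T ^ n).1 ⁻¹' Y ∩ Y ⊆ ((T ^ n).1 ⁻¹' Y ∩ Y ∩ (g n).1 ⁻¹' C) ∪
          ((T ^ n).1 ⁻¹' ((((T ^ n)⁻¹ * S).1 ⁻¹' C) ∆ (((T ^ n)⁻¹).1 ⁻¹' C))) := by
        intro y hy
        by_cases hyC : (g n).1 y ∈ C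
        · exact Or.inl ⟨hy, hyC⟩
        · refine Or.inr (Or.inr ⟨?_, hyC⟩)
          have : ((T ^ n)⁻¹).1 ((T ^ n).1 y) = y := (T ^ n).1.symm_apply_apply y
          simpa [Set.mem_preimage, this] using hYC hy.2
      calc _ ≤ _ := measureReal_mono hsub
        _ ≤ _ := measureReal_union_le _ _
        _ = _ := by rw [measureReal_def, hcon n]; simp
    have hmove : ∀ y ∈ (T ^ n).1 ⁻¹' Y ∩ Y ∩ (g n).1 ⁻¹' C, y ≠ (g n).1 y := by
      intro y hy hyn
      refine hYU _ hy.1.1 ?_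
      have : (T ^ n).1 ((g n).1 y) = S.1 ((T ^ n).1 y) := (T ^ n).1.apply_symm_apply _
      rw [← this, ← hyn]
    obtain ⟨C', hC'm, hC'⟩ := exists_measure_separated_ne_zero (a := _root_.id)
      (b := (g n).1) hn hmove
    refine ⟨Fin.snoc k n, _, C ∩ C', ?_, hCm.inter hC'm, hC', fun y hy => hYU y hy.1.1.2,
      fun y hy => ⟨hYC hy.1.1.2, hy.2.1⟩, ?_, ?_⟩
    · exact ((((T ^ n).2.1.measurable hYm).inter hYm).inter (MPAut.measurable _ hCm)).inter
        (hC'm.inter (MPAut.measurable _ hC'm.compl))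
    · intro y hy i
      refine Fin.lastCases ?_ (fun i => ?_) i
      · rw [Fin.snoc_last]
        exact fun h => hy.2.2 h.2
      · rw [Fin.snoc_castSucc]
        exact fun h => hout y hy.1.1.2 i h.1
    · intro y hy i j hij
      induction i using Fin.lastCases with
      | last =>
        induction j using Fin.lastCases with
        | last => exact absurd rfl hij
        | cast j =>
          rw [Fin.snoc_last, Fin.snoc_castSucc]
          exact fun h => hout y hy.1.1.2 j (h ▸ hy.1.2)
      | cast i =>
        induction j using Fin.lastCases with
        | last =>
          rw [Fin.snoc_last, Fin.snoc_castSucc]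
          exact fun h => hout y hy.1.1.2 i (h.symm ▸ hy.1.2)
        | cast j =>
          rw [Fin.snoc_castSucc, Fin.snoc_castSucc]
          exact hpair y hy.1.1.2 fun h => hij (by rw [h])

end

/-! ### Asymptotically invariant sets; towers -/

section

variable {X : Type*} [MeasurableSpace X] {μ : Measure X}

theorem norm_indL2_le_one [IsProbabilityMeasure μ] {A : Set X} (hA : MeasurableSet A) :
    ‖indL2 μ hA‖ ≤ 1 := by
  have h : ‖indL2 μ hA‖ ^ 2 ≤ 1 ^ 2 := by
    rw [← real_inner_self_eq_norm_sq, inner_indL2, one_pow]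
    exact measureReal_le_one
  exact (abs_le_of_sq_le_sq' h zero_le_one).2

/-- The mean ergodic theorem for an ergodic transformation: the invariant limit is constant. -/
theorem Ergodic.tendsto_average_indL2 [IsProbabilityMeasure μ] {T : MPAut μ}
    (hT : Ergodic T.1 μ) {A : Set X} (hA : MeasurableSet A) :
    Tendsto (fun N : ℕ => (N : ℝ)⁻¹ • ∑ n ∈ Finset.Icc 1 N,
        indL2 μ (MPAut.measurable (T ^ n) hA)) atTop
      (𝓝 (μ.real A • indL2 μ MeasurableSet.univ)) := by
  obtain ⟨φ, hφ, hlim⟩ := exists_tendsto_average_indL2 T hA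
  have hinv : φ ∘ T.1 =ᵐ[μ] φ := by
    have h1 : koopman μ ((T⁻¹ : MPAut μ) : AutGroup μ) φ =ᵐ[μ] φ ∘ T.1 :=
      Lp.coeFn_compMeasurePreserving φ T.2.1
    rw [hφ] at h1
    exact h1.symm
  obtain ⟨c, hc⟩ := hT.ae_eq_const_of_ae_eq_comp_ae (Lp.aestronglyMeasurable φ) hinv
  have hφc : φ = c • indL2 μ MeasurableSet.univ := by
    refine Lp.ext (hc.trans ?_)
    filter_upwards [Lp.coeFn_smul c (indL2 μ MeasurableSet.univ),
      indicatorConstLp_coeFn (p := 2) (hs := MeasurableSet.univ) (hμs := measure_ne_top μ _)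
        (c := (1 : ℝ))] with x h1 h2
    rw [h1, Pi.smul_apply, h2]
    simp
  suffices c = μ.real A by rw [← this, ← hφc]; exact hlim
  have h1 : inner ℝ φ (indL2 μ MeasurableSet.univ) = c := by
    rw [hφc, real_inner_smul_left, inner_indL2]
    simp
  rw [← h1]
  refine tendsto_nhds_unique (hlim.inner (𝕜 := ℝ) (tendsto_const_nhds
    (x := indL2 μ MeasurableSet.univ))) (tendsto_const_nhds.congr' ?_)
  filter_upwards [eventually_gt_atTop 0] with N hN
  have hN' : (N : ℝ) ≠ 0 := by positivity
  rw [real_inner_smul_left, sum_inner]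
  simp_rw [inner_indL2, Set.inter_univ]
  rw [Finset.sum_congr rfl fun n _ => MPAut.measureReal_preimage (T ^ n) hA, Finset.sum_const,
    Nat.card_Icc, nsmul_eq_mul, Nat.add_sub_cancel, inv_mul_cancel_left₀ hN']

theorem measureReal_preimage_pow_symmDiff_le [IsFiniteMeasure μ] (T : MPAut μ) {F : Set X}
    (hF : MeasurableSet F) (n : ℕ) :
    μ.real (((T ^ n).1 ⁻¹' F) ∆ F) ≤ n * μ.real ((T.1 ⁻¹' F) ∆ F) := by
  induction n with
  | zero => simp
  | succ n ih =>
    have e : (T ^ (n + 1)).1 ⁻¹' F = T.1 ⁻¹' ((T ^ n).1 ⁻¹' F) := by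
      rw [pow_succ]; rfl
    have hm := MPAut.measurable (T ^ n) hF
    have h := measureReal_symmDiff_le (μ := μ) (s := (T ^ (n + 1)).1 ⁻¹' F) (t := T.1 ⁻¹' F) F
    rw [e, ← Set.preimage_symmDiff, MPAut.measureReal_preimage _ (hm.symmDiff hF)] at h
    rw [e]
    rw [Nat.cast_succ]
    linarith

/-- Asymptotically invariant sets are asymptotically independent of every fixed set, when the
transformation is ergodic. -/
theorem Ergodic.tendsto_measureReal_inter [IsProbabilityMeasure μ] {T : MPAut μ}
    (hT : Ergodic T.1 μ) {ι : Type*} {l : Filter ι} {F : ι → Set X} {c : ℝ}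
    (hF : ∀ j, MeasurableSet (F j))
    (hinv : Tendsto (fun j => μ.real ((T.1 ⁻¹' F j) ∆ F j)) l (𝓝 0))
    (hc : Tendsto (fun j => μ.real (F j)) l (𝓝 c)) {A : Set X} (hA : MeasurableSet A) :
    Tendsto (fun j => μ.real (F j ∩ A)) l (𝓝 (c * μ.real A)) := by
  rw [Metric.tendsto_nhds]
  intro ε hε
  have hav := hT.tendsto_average_indL2 hA
  obtain ⟨N, hN, hN0⟩ := ((Metric.tendsto_nhds.1 hav (ε / 4) (by positivity)).and
    (eventually_gt_atTop 0)).exists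
  have hN' : (0 : ℝ) < N := by exact_mod_cast hN0
  filter_upwards [Metric.tendsto_nhds.1 hinv (ε / (4 * N)) (by positivity),
    Metric.tendsto_nhds.1 hc (ε / 4) (by positivity)] with j h1 h2
  rw [Real.dist_eq] at h1 h2 ⊢
  rw [sub_zero, abs_of_nonneg measureReal_nonneg, lt_div_iff₀ (by positivity)] at h1
  have hstep : ∀ n ∈ Finset.Icc 1 N,
      |μ.real ((T ^ n).1 ⁻¹' A ∩ F j) - μ.real (F j ∩ A)| ≤ ε / 4 := by
    intro n hn
    have hle := measureReal_preimage_pow_symmDiff_le T (hF j) n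
    have hnN : (n : ℝ) ≤ N := by exact_mod_cast (Finset.mem_Icc.1 hn).2
    have hle2 : μ.real (((T ^ n).1 ⁻¹' F j) ∆ F j) ≤ ε / 4 := by
      have := mul_le_mul_of_nonneg_right hnN
        (measureReal_nonneg (μ := μ) (s := (T.1 ⁻¹' F j) ∆ F j))
      linarith
    rw [← MPAut.measureReal_preimage (T ^ n) ((hF j).inter hA)]
    refine (abs_measureReal_sub_le_measureReal_symmDiff
      ((MPAut.measurable (T ^ n) hA).inter (hF j)).nullMeasurableSet
      (MPAut.measurable (T ^ n) ((hF j).inter hA)).nullMeasurableSet).trans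
      ((measureReal_mono ?_).trans hle2)
    intro x hx
    rcases hx with ⟨h3, h4⟩ | ⟨h3, h4⟩
    · exact Or.inr ⟨h3.2, fun h => h4 ⟨h, h3.1⟩⟩
    · exact Or.inl ⟨h3.1, fun h => h4 ⟨h3.2, h⟩⟩
  -- compare `μ(F j ∩ A)` with the average of the `μ(F j ∩ T⁻ⁿA)`, `n ≤ N`, and the latter with its
  -- ergodic limit
  set V := (N : ℝ)⁻¹ • ∑ n ∈ Finset.Icc 1 N, indL2 μ (MPAut.measurable (T ^ n) hA)
  have hV : inner ℝ V (indL2 μ (hF j)) =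
      (N : ℝ)⁻¹ * ∑ n ∈ Finset.Icc 1 N, μ.real ((T ^ n).1 ⁻¹' A ∩ F j) := by
    rw [real_inner_smul_left, sum_inner]
    simp_rw [inner_indL2]
  have hclose : |inner ℝ V (indL2 μ (hF j)) - μ.real A * μ.real (F j)| ≤ ε / 4 := by
    have e : μ.real A * μ.real (F j) =
        inner ℝ (μ.real A • indL2 μ MeasurableSet.univ) (indL2 μ (hF j)) := by
      rw [real_inner_smul_left, inner_indL2, Set.univ_inter]
    rw [e, ← inner_sub_left]
    refine (abs_real_inner_le_norm _ _).trans ?_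
    rw [dist_eq_norm] at hN
    have := mul_le_mul hN.le (norm_indL2_le_one (μ := μ) (hF j)) (norm_nonneg _) (by positivity)
    linarith
  have hsum : |inner ℝ V (indL2 μ (hF j)) - μ.real (F j ∩ A)| ≤ ε / 4 := by
    have e : inner ℝ V (indL2 μ (hF j)) - μ.real (F j ∩ A) = (N : ℝ)⁻¹ *
        ∑ n ∈ Finset.Icc 1 N, (μ.real ((T ^ n).1 ⁻¹' A ∩ F j) - μ.real (F j ∩ A)) := by
      rw [hV, Finset.sum_sub_distrib, Finset.sum_const, Nat.card_Icc, nsmul_eq_mul,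
        Nat.add_sub_cancel, mul_sub, inv_mul_cancel_left₀ hN'.ne']
    rw [e, abs_mul, abs_of_pos (inv_pos.2 hN'), inv_mul_le_iff₀ hN']
    refine (Finset.abs_sum_le_sum_abs _ _).trans ((Finset.sum_le_sum hstep).trans ?_)
    rw [Finset.sum_const, Nat.card_Icc, nsmul_eq_mul, Nat.add_sub_cancel]
  have hAF : |μ.real A * μ.real (F j) - c * μ.real A| ≤ ε / 4 := by
    have e : μ.real A * μ.real (F j) - c * μ.real A = μ.real A * (μ.real (F j) - c) := by ring
    rw [e, abs_mul, abs_of_nonneg measureReal_nonneg]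
    exact (mul_le_of_le_one_left (abs_nonneg _) (measureReal_le_one (μ := μ))).trans h2.le
  rw [abs_le] at *
  rw [abs_lt]
  constructor <;> linarith [hclose.1, hclose.2, hsum.1, hsum.2, hAF.1, hAF.2]

namespace TowerPartition

variable {T : Equiv.Perm X}

/-- The level `Tᵏ B` of the tower. -/
def level (ξ : TowerPartition T) (k : ℕ) : Set X := T^[k] '' ξ.base

theorem Saturated.mem_iff {ξ : TowerPartition T} {E : Set X} (hE : ξ.Saturated E) {k : ℕ}
    (hk : k < ξ.height) {x y : X} (hx : x ∈ ξ.level k) (hy : y ∈ ξ.level k) :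
    x ∈ E ↔ y ∈ E := by
  obtain ⟨I, rfl⟩ := hE
  have key : ∀ z ∈ ξ.level k, z ∈ (⋃ i ∈ I, ξ.cell i) ↔ Sum.inl ⟨k, hk⟩ ∈ I := by
    intro z hz
    have hz' : z ∈ ξ.cell (Sum.inl ⟨k, hk⟩) := hz
    simp only [Set.mem_iUnion, exists_prop]
    constructor
    · rintro ⟨i, hi, hzi⟩
      by_contra hcon
      have hne : i ≠ Sum.inl ⟨k, hk⟩ := fun h => hcon (h ▸ hi)
      exact Set.disjoint_left.1 (ξ.disj hne) hzi hz'
    · exact fun h => ⟨_, h, hz'⟩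
  rw [key x hx, key y hy]

theorem level_disjoint (ξ : TowerPartition T) {k l : ℕ} (hk : k < ξ.height) (hl : l < ξ.height)
    (hkl : k ≠ l) : Disjoint (ξ.level k) (ξ.level l) :=
  ξ.disj (i := Sum.inl ⟨k, hk⟩) (j := Sum.inl ⟨l, hl⟩) (by simpa using hkl)

theorem iterate_mem_level {ξ : TowerPartition T} {k : ℕ} {x : X} (n : ℕ) :
    T^[n] x ∈ ξ.level (k + n) ↔ x ∈ ξ.level k := by
  rw [level, level, add_comm, Function.iterate_add, Set.image_comp,
    (T.injective.iterate n).mem_set_image]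

theorem mem_tower {ξ : TowerPartition T} {x : X} :
    x ∈ ξ.tower ↔ ∃ k < ξ.height, x ∈ ξ.level k := by
  simp only [tower, Set.mem_iUnion, level]
  exact ⟨fun ⟨k, hk⟩ => ⟨k, k.2, hk⟩, fun ⟨k, hk, h⟩ => ⟨⟨k, hk⟩, h⟩⟩

end TowerPartition

variable {T : MPAut μ}

namespace TowerPartition

theorem level_eq_preimage (ξ : TowerPartition T.1) (k : ℕ) :
    ξ.level k = ((T ^ k)⁻¹).1 ⁻¹' ξ.base := by
  rw [level, ← MPAut.coe_pow]
  exact (T ^ k).1.image_eq_preimage_symm _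

theorem measurableSet_level (ξ : TowerPartition T.1) (k : ℕ) : MeasurableSet (ξ.level k) := by
  rw [level_eq_preimage]
  exact MPAut.measurable _ ξ.base_meas

theorem measureReal_level (ξ : TowerPartition T.1) (k : ℕ) :
    μ.real (ξ.level k) = μ.real ξ.base := by
  rw [level_eq_preimage, MPAut.measureReal_preimage _ ξ.base_meas]

theorem measureReal_biUnion_level [IsFiniteMeasure μ] (ξ : TowerPartition T.1) {s : Finset ℕ}
    (hs : ∀ k ∈ s, k < ξ.height) :
    μ.real (⋃ k ∈ s, ξ.level k) = s.card * μ.real ξ.base := by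
  rw [measureReal_biUnion_finset (fun i hi j hj hij => ξ.level_disjoint (hs i hi) (hs j hj) hij)
    (fun k _ => ξ.measurableSet_level k), Finset.sum_congr rfl fun k _ => ξ.measureReal_level k,
    Finset.sum_const, nsmul_eq_mul]

theorem tower_eq (ξ : TowerPartition T.1) :
    ξ.tower = ⋃ k ∈ Finset.range ξ.height, ξ.level k := by
  ext x
  rw [mem_tower]
  simp

theorem measureReal_tower [IsFiniteMeasure μ] (ξ : TowerPartition T.1) :
    μ.real ξ.tower = ξ.height * μ.real ξ.base := by
  rw [tower_eq, measureReal_biUnion_level ξ (by simp), Finset.card_range]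

theorem measurableSet_biUnion_level (ξ : TowerPartition T.1) (s : Finset ℕ) :
    MeasurableSet (⋃ k ∈ s, ξ.level k) :=
  s.measurableSet_biUnion fun k _ => ξ.measurableSet_level k

theorem measurableSet_tower (ξ : TowerPartition T.1) : MeasurableSet ξ.tower := by
  rw [tower_eq]
  exact ξ.measurableSet_biUnion_level _

end TowerPartition

end

/-! ### Approximating towers separate points -/

section

variable {X : Type*} [MeasurableSpace X] {μ : Measure X}

/-- Every measurable set is approximated in measure by sets that are unions of elements of the
partitions `ξ j`. -/
def TowerPartition.Approximates {T : Equiv.Perm X} (μ : Measure X) (ξ : ℕ → TowerPartition T) :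
    Prop :=
  ∀ A : Set X, MeasurableSet A → ∃ E : ℕ → Set X, (∀ j, (ξ j).Saturated (E j)) ∧
    Tendsto (fun j => μ.real (E j ∆ A)) atTop (𝓝 0)

theorem HasTowers.exists_approximates {T : Equiv.Perm X} {β : ℝ} [IsFiniteMeasure μ]
    (h : HasTowers μ T β) : ∃ ξ : ℕ → TowerPartition T, TowerPartition.Approximates μ ξ ∧
      Tendsto (fun j => μ.real (ξ j).tower) atTop (𝓝 β) := by
  obtain ⟨hβ, ξ, h1, h2⟩ := h
  refine ⟨ξ, fun A hA => ?_, ?_⟩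
  · obtain ⟨E, hE, hlim⟩ := h1 A hA
    exact ⟨E, hE, (ENNReal.tendsto_toReal ENNReal.zero_ne_top).comp hlim⟩
  · have := (ENNReal.tendsto_toReal ENNReal.ofReal_ne_top).comp h2
    rwa [ENNReal.toReal_ofReal hβ.le] at this

namespace TowerPartition

theorem Saturated.measurableSet {T : MPAut μ} {ξ : TowerPartition T.1} {E : Set X}
    (hE : ξ.Saturated E) : MeasurableSet E := by
  obtain ⟨I, rfl⟩ := hE
  refine MeasurableSet.biUnion I.to_countable fun i _ => ?_
  rcases i with k | i
  · exact ξ.measurableSet_level k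
  · exact ξ.rest_meas i

variable {T : MPAut μ}

/-- Two distinct points rarely lie in the same level of an approximating tower: a separating
sequence of sets is approximated by unions of elements of the partition. -/
theorem Approximates.tendsto_sameLevel [MeasurableSpace.CountablySeparated X]
    {ξ : ℕ → TowerPartition T.1} (hξ : Approximates μ ξ) {Ω : Type*} [MeasurableSpace Ω]
    {P : Measure Ω} [IsFiniteMeasure P] {a b : Ω → X} (ha : MeasurePreserving a P μ)
    (hb : MeasurePreserving b P μ) :
    Tendsto (fun j => P.real {ω | a ω ≠ b ω ∧
      ∃ k < (ξ j).height, a ω ∈ (ξ j).level k ∧ b ω ∈ (ξ j).level k}) atTop (𝓝 0) := by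
  obtain ⟨C, hC, hsep⟩ := exists_seq_separating X (p := MeasurableSet) MeasurableSet.empty Set.univ
  choose E hE hElim using fun l => hξ (C l) (hC l)
  set W : ℕ → Set Ω := fun l => (a ⁻¹' C l) ∆ (b ⁻¹' C l) with hW
  have hWm : ∀ l, MeasurableSet (W l) := fun l =>
    (ha.measurable (hC l)).symmDiff (hb.measurable (hC l))
  -- the pairs of distinct points that are not separated by the first `L` sets
  set D : ℕ → Set Ω := fun L => (⋃ l, W l) \ ⋃ l ∈ Finset.range L, W l with hD
  have hDlim : Tendsto (fun L => P.real (D L)) atTop (𝓝 0) := by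
    have h1 : Tendsto (fun L => P (D L)) atTop (𝓝 (P (⋂ L, D L))) := by
      refine tendsto_measure_iInter_atTop (fun L => ?_) ?_ ⟨0, measure_ne_top _ _⟩
      · exact ((MeasurableSet.iUnion hWm).diff
          (Finset.measurableSet_biUnion _ fun l _ => hWm l)).nullMeasurableSet
      · intro L L' hLL'
        exact Set.sdiff_subset_sdiff_right (Set.biUnion_subset_biUnion_left
          (Finset.coe_subset.2 (Finset.range_subset_range.2 hLL')))
    have h2 : ⋂ L, D L = ∅ := by
      ext ω
      simp only [Set.mem_iInter, Set.mem_empty_iff_false, iff_false]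
      intro h
      obtain ⟨l, hl⟩ := Set.mem_iUnion.1 (h 0).1
      refine (h (l + 1)).2 (Set.mem_biUnion ?_ hl)
      simp
    rw [h2, measure_empty] at h1
    exact (ENNReal.tendsto_toReal ENNReal.zero_ne_top).comp h1
  rw [Metric.tendsto_nhds]
  intro ε hε
  obtain ⟨L, hL⟩ := ((Metric.tendsto_nhds.1 hDlim) (ε / 2) (by positivity)).exists
  have hsum : Tendsto (fun j => ∑ l ∈ Finset.range L, 2 * μ.real (E l j ∆ C l)) atTop (𝓝 0) := by
    have := tendsto_finsetSum (Finset.range L) fun l _ => (hElim l).const_mul (2 : ℝ)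
    simpa using this
  filter_upwards [Metric.tendsto_nhds.1 hsum (ε / 2) (by positivity)] with j hj
  rw [Real.dist_eq, sub_zero] at *
  rw [abs_of_nonneg measureReal_nonneg]
  have hsub : {ω | a ω ≠ b ω ∧ ∃ k < (ξ j).height, a ω ∈ (ξ j).level k ∧ b ω ∈ (ξ j).level k} ⊆
      D L ∪ ⋃ l ∈ Finset.range L, (a ⁻¹' (E l j ∆ C l) ∪ b ⁻¹' (E l j ∆ C l)) := by
    rintro ω ⟨hne, k, hk, hak, hbk⟩
    by_cases hω : ω ∈ ⋃ l ∈ Finset.range L, W l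
    · right
      obtain ⟨l, hl, hωl⟩ := Set.mem_iUnion₂.1 hω
      refine Set.mem_biUnion hl ?_
      have hiff := (hE l j).mem_iff hk hak hbk
      simp only [hW, Set.mem_symmDiff, Set.mem_preimage, Set.mem_union] at hωl ⊢
      tauto
    · refine Or.inl ⟨?_, hω⟩
      by_contra hcon
      refine hne (hsep _ trivial _ trivial fun l => ?_)
      have : ω ∉ W l := fun h => hcon (Set.mem_iUnion.2 ⟨l, h⟩)
      simp only [hW, Set.mem_symmDiff, Set.mem_preimage] at this
      tauto
  have hle : P.real (⋃ l ∈ Finset.range L, (a ⁻¹' (E l j ∆ C l) ∪ b ⁻¹' (E l j ∆ C l))) ≤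
      ∑ l ∈ Finset.range L, 2 * μ.real (E l j ∆ C l) := by
    refine (measureReal_biUnion_finset_le _ _).trans (Finset.sum_le_sum fun l _ => ?_)
    refine (measureReal_union_le _ _).trans ?_
    have hm := (hE l j).measurableSet.symmDiff (hC l)
    rw [ha.measureReal_preimage hm.nullMeasurableSet, hb.measureReal_preimage hm.nullMeasurableSet]
    linarith
  have h1 := measureReal_mono (μ := P) hsub
  have h2 := measureReal_union_le (μ := P) (D L)
    (⋃ l ∈ Finset.range L, (a ⁻¹' (E l j ∆ C l) ∪ b ⁻¹' (E l j ∆ C l)))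
  have h3 := (abs_lt.1 hL).2
  have h4 := (abs_lt.1 hj).2
  linarith

/-- Without atoms the levels become small: by `Approximates.tendsto_sameLevel`, applied to the two
projections of `X × X`, the product measure of `B ×ˢ B` tends to zero. -/
theorem Approximates.tendsto_measureReal_base [StandardBorelSpace X]
    [IsProbabilityMeasure μ] (hatom : ∀ x, μ {x} = 0)
    {ξ : ℕ → TowerPartition T.1} (hξ : Approximates μ ξ)
    {β : ℝ} (hβ : 0 < β) (htower : Tendsto (fun j => μ.real (ξ j).tower) atTop (𝓝 β)) :
    Tendsto (fun j => μ.real (ξ j).base) atTop (𝓝 0) := by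
  have h := hξ.tendsto_sameLevel (P := μ.prod μ) (measurePreserving_fst (μ := μ) (ν := μ))
    (measurePreserving_snd (μ := μ) (ν := μ))
  have hdiag : (μ.prod μ) {p : X × X | p.1 = p.2} = 0 := by
    have hm : MeasurableSet {p : X × X | p.1 = p.2} := 
      measurableSet_eq_fun measurable_fst measurable_snd
    rw [Measure.measure_prod_null hm]
    refine ae_of_all _ fun x => ?_
    have : Prod.mk x ⁻¹' {p : X × X | p.1 = p.2} = {x} := by
      ext y
      simp [eq_comm]
    change μ _ = 0
    rw [this]
    exact hatom x
  have hsq : Tendsto (fun j => μ.real (ξ j).base ^ 2) atTop (𝓝 0) := by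
    refine squeeze_zero' (Eventually.of_forall fun j => by positivity) ?_ h
    filter_upwards [htower.eventually (lt_mem_nhds hβ)] with j hj
    have hpos : 0 < (ξ j).height := by
      rw [measureReal_tower] at hj
      rcases Nat.eq_zero_or_pos (ξ j).height with h0 | h0
      · simp [h0] at hj
      · exact h0
    have h1 : μ.real (ξ j).base ^ 2 = (μ.prod μ).real ((ξ j).base ×ˢ (ξ j).base) := by
      rw [measureReal_prod_prod, sq]
    have h2 : (μ.prod μ).real {p : X × X | p.1 = p.2} = 0 := by
      rw [measureReal_def, hdiag, ENNReal.toReal_zero]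
    have h3 : (ξ j).base ×ˢ (ξ j).base ⊆ {p : X × X | p.1 = p.2} ∪ {p : X × X | p.1 ≠ p.2 ∧
        ∃ k < (ξ j).height, p.1 ∈ (ξ j).level k ∧ p.2 ∈ (ξ j).level k} := by
      rintro p ⟨hp1, hp2⟩
      by_cases hp : p.1 = p.2
      · exact Or.inl hp
      · exact Or.inr ⟨hp, 0, hpos, by simpa [level] using hp1, by simpa [level] using hp2⟩
    have h4 := (measureReal_mono (μ := μ.prod μ) h3).trans (measureReal_union_le _ _)
    linarith
  have := hsq.sqrt
  simpa [Real.sqrt_sq measureReal_nonneg] using this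

end TowerPartition

end

/-! ### Shifts inside a tower -/

section

variable {X : Type*} [MeasurableSpace X] {μ : Measure X}

/-- Subsets of `Y` whose total measure exceeds that of `Y` overlap, also outside a small set `Z`. -/
theorem exists_mem_inter_of_lt_sum_measureReal {ι : Type*} [Fintype ι] [IsFiniteMeasure μ]
    {V : ι → Set X} {Y Z : Set X} (hV : ∀ i, MeasurableSet (V i)) (hVY : ∀ i, V i ⊆ Y)
    (h : μ.real Y + Fintype.card ι * μ.real Z < ∑ i, μ.real (V i)) :
    ∃ i k, i ≠ k ∧ ∃ y, y ∈ V i ∧ y ∈ V k ∧ y ∉ Z := by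
  by_contra! hcon
  set Z' := toMeasurable μ Z with hZ'
  have hZm : μ.real Z' = μ.real Z := by rw [measureReal_def, measureReal_def, measure_toMeasurable]
  have h1 : ∑ i, μ.real (V i \ Z') ≤ μ.real Y := by
    rw [← measureReal_iUnion_fintype]
    · exact measureReal_mono (Set.iUnion_subset fun i => Set.sdiff_subset.trans (hVY i))
    · intro i k hik
      refine Set.disjoint_left.2 fun y hy hy' => ?_
      exact hy.2 (subset_toMeasurable μ Z (hcon i k hik y hy.1 hy'.1))
    · exact fun i => (hV i).diff (measurableSet_toMeasurable μ Z)
  have h2 : ∑ i, μ.real (V i) ≤ ∑ i, (μ.real (V i \ Z') + μ.real Z) := by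
    refine Finset.sum_le_sum fun i _ => ?_
    rw [← hZm]
    exact (measureReal_mono (by rw [Set.sdiff_union_self]; exact Set.subset_union_left)).trans
      (measureReal_union_le _ _)
  rw [Finset.sum_add_distrib, Finset.sum_const, nsmul_eq_mul, Finset.card_univ] at h2
  linarith

/-- Markov's inequality for the number of the sets `F n`, `n ∈ s`, that contain a point. -/
theorem measureReal_lt_sum_indicator_mul_le [IsFiniteMeasure μ] (s : Finset ℕ) {F : ℕ → Set X}
    (hF : ∀ n, MeasurableSet (F n)) (c : ℝ) :
    c * μ.real {y | c < ∑ n ∈ s, (F n).indicator (fun _ => (1 : ℝ)) y} ≤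
      ∑ n ∈ s, μ.real (F n) := by
  rcases lt_or_ge c 0 with hc | hc
  · exact (mul_nonpos_of_nonpos_of_nonneg hc.le measureReal_nonneg).trans
      (Finset.sum_nonneg fun _ _ => measureReal_nonneg)
  have hint : ∀ n, Integrable ((F n).indicator (fun _ => (1 : ℝ))) μ := fun n =>
    (integrable_const 1).indicator (hF n)
  have h := mul_meas_ge_le_integral_of_nonneg (μ := μ)
    (f := fun y => ∑ n ∈ s, (F n).indicator (fun _ => (1 : ℝ)) y)
    (ae_of_all _ fun y => Finset.sum_nonneg fun n _ => Set.indicator_nonneg (by simp) _)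
    (integrable_finsetSum s fun n _ => hint n) c
  rw [integral_finsetSum s fun n _ => hint n] at h
  simp_rw [integral_indicator_const _ (hF _), smul_eq_mul, mul_one] at h
  exact (mul_le_mul_of_nonneg_left (measureReal_mono fun y (hy : c < _) => hy.le) hc).trans h

namespace TowerPartition

variable {T : MPAut μ}

theorem inv_pow_mem_level {ξ : TowerPartition T.1} {p n : ℕ} (hn : n ≤ p) {x : X}
    (hx : x ∈ ξ.level p) : ((T ^ n)⁻¹).1 x ∈ ξ.level (p - n) := by
  rw [← iterate_mem_level n, Nat.sub_add_cancel hn, ← MPAut.coe_pow]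
  have : (T ^ n).1 (((T ^ n)⁻¹).1 x) = x := (T ^ n).1.apply_symm_apply x
  rwa [this]

/-- If two points at the levels `p` and `p + m` of a tower have visited a union `E` of levels
at the same times `n ∈ s` of their pasts, then `E` is invariant under the shift by `m` on all
the levels `p - n`, and `Tᵐ` moves few points of the tower out of a set approximated by `E`. -/
theorem measureReal_tower_inter_le [IsFiniteMeasure μ] {ξ : TowerPartition T.1} {A B E : Set X}
    (hA : MeasurableSet A) (hE : ξ.Saturated E) {p m N : ℕ} (hNp : N ≤ p)
    (hpm : p + m < ξ.height) {x x' : X} (hx : x ∈ ξ.level p) (hx' : x' ∈ ξ.level (p + m))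
    {s : Finset ℕ} (hs : s ⊆ Finset.Icc 1 N)
    (hgood : ∀ n ∈ s, ((T ^ n)⁻¹).1 x ∈ E ↔ ((T ^ n)⁻¹).1 x' ∈ E) :
    μ.real (ξ.tower ∩ (A ∩ B)) ≤ μ.real ((T ^ m).1 ⁻¹' A ∩ B) +
      (ξ.height - s.card) * μ.real ξ.base + 2 * μ.real (E ∆ A) := by
  have hsle : ∀ n ∈ s, n ≤ p := fun n hn => (Finset.mem_Icc.1 (hs hn)).2.trans hNp
  set I : Finset ℕ := s.image fun n => p - n with hI
  have hIcard : I.card = s.card := Finset.card_image_of_injOn fun a ha b hb hab => by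
    have := hsle a ha
    have := hsle b hb
    have hab : p - a = p - b := hab
    omega
  have hIlt : ∀ i ∈ I, i < ξ.height := by
    intro i hi
    obtain ⟨n, hn, rfl⟩ := Finset.mem_image.1 hi
    omega
  set G := ⋃ i ∈ I, ξ.level i with hG
  have hGm : MeasurableSet G := ξ.measurableSet_biUnion_level I
  have hGt : G ⊆ ξ.tower := by
    rw [tower_eq]
    exact Set.biUnion_subset_biUnion_left fun i hi => by simpa using hIlt i hi
  have hdiff : μ.real (ξ.tower \ G) = (ξ.height - s.card) * μ.real ξ.base := by
    rw [measureReal_sdiff hGt hGm, measureReal_tower, measureReal_biUnion_level ξ hIlt, hIcard]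
    ring
  have hEA := hE.measurableSet.symmDiff hA
  have hsub : ξ.tower ∩ (A ∩ B) ⊆ (((T ^ m).1 ⁻¹' A ∩ B) ∪ (ξ.tower \ G)) ∪
      (E ∆ A ∪ (T ^ m).1 ⁻¹' (E ∆ A)) := by
    rintro z ⟨hzt, hzA, hzB⟩
    by_cases hzG : z ∈ G
    swap
    · exact Or.inl (Or.inr ⟨hzt, hzG⟩)
    obtain ⟨i, hi, hzi⟩ := Set.mem_iUnion₂.1 hzG
    obtain ⟨n, hn, rfl⟩ := Finset.mem_image.1 hi
    have hnp := hsle n hn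
    by_cases hzE : z ∈ E
    swap
    · exact Or.inr (Or.inl (Or.inr ⟨hzA, hzE⟩))
    have h1 : ((T ^ n)⁻¹).1 x ∈ E :=
      (hE.mem_iff (by omega) hzi (inv_pow_mem_level hnp hx)).1 hzE
    have h2 : (T ^ m).1 z ∈ ξ.level (p + m - n) := by
      have := (iterate_mem_level m).2 hzi
      rw [← MPAut.coe_pow] at this
      rwa [show p + m - n = p - n + m by omega]
    have h3 : (T ^ m).1 z ∈ E :=
      (hE.mem_iff (by omega) (inv_pow_mem_level (by omega) hx') h2).1 ((hgood n hn).1 h1)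
    by_cases h4 : (T ^ m).1 z ∈ A
    · exact Or.inl (Or.inl ⟨h4, hzB⟩)
    · exact Or.inr (Or.inr (Or.inl ⟨h3, h4⟩))
  have h1 := measureReal_mono (μ := μ) hsub
  have h2 := measureReal_union_le (μ := μ) (((T ^ m).1 ⁻¹' A ∩ B) ∪ (ξ.tower \ G))
      (E ∆ A ∪ (T ^ m).1 ⁻¹' (E ∆ A))
  have h3 := measureReal_union_le (μ := μ) ((T ^ m).1 ⁻¹' A ∩ B) (ξ.tower \ G)
  have h4 := measureReal_union_le (μ := μ) (E ∆ A) ((T ^ m).1 ⁻¹' (E ∆ A))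
  rw [MPAut.measureReal_preimage _ hEA] at h4
  linarith

/-- The levels `a, …, h - 1` of a tower of height `h`. -/
def top (ξ : TowerPartition T.1) (a : ℕ) : Set X :=
  ⋃ k ∈ Finset.Ico a ξ.height, ξ.level k

theorem mem_top {ξ : TowerPartition T.1} {a : ℕ} {x : X} :
    x ∈ ξ.top a ↔ ∃ k, a ≤ k ∧ k < ξ.height ∧ x ∈ ξ.level k := by
  simp [top, and_assoc]

theorem measurableSet_top (ξ : TowerPartition T.1) (a : ℕ) : MeasurableSet (ξ.top a) :=
  ξ.measurableSet_biUnion_level _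

theorem measureReal_top [IsFiniteMeasure μ] (ξ : TowerPartition T.1) (a : ℕ) :
    μ.real (ξ.top a) = (ξ.height - a : ℕ) * μ.real ξ.base := by
  rw [top, measureReal_biUnion_level ξ (fun k hk => (Finset.mem_Ico.1 hk).2), Nat.card_Ico]

theorem measureReal_preimage_top_symmDiff_le [IsFiniteMeasure μ] (ξ : TowerPartition T.1)
    (a : ℕ) : μ.real ((T.1 ⁻¹' ξ.top a) ∆ ξ.top a) ≤ 2 * μ.real ξ.base := by
  have hsub : (T.1 ⁻¹' ξ.top a) ∆ ξ.top a ⊆ T.1 ⁻¹' ξ.level a ∪ ξ.level (ξ.height - 1) := by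
    rintro x (⟨h1, h2⟩ | ⟨h1, h2⟩)
    · obtain ⟨k, hak, hk, hxk⟩ := mem_top.1 h1
      rcases hak.eq_or_lt with rfl | hlt
      · exact Or.inl hxk
      · refine absurd (mem_top.2 ⟨k - 1, by omega, by omega, ?_⟩) h2
        have := (iterate_mem_level (ξ := ξ) (k := k - 1) (x := x) 1).1
        rw [Nat.sub_add_cancel (by omega)] at this
        exact this hxk
    · obtain ⟨k, hak, hk, hxk⟩ := mem_top.1 h1
      have hx1 : T.1 x ∈ ξ.level (k + 1) := (iterate_mem_level 1).2 hxk
      by_cases hk1 : k + 1 < ξ.height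
      · exact absurd (mem_top.2 ⟨k + 1, by omega, hk1, hx1⟩) h2
      · right
        rwa [show ξ.height - 1 = k by omega]
  have h1 := (measureReal_mono (μ := μ) hsub).trans (measureReal_union_le _ _)
  rw [MPAut.measureReal_preimage _ (ξ.measurableSet_level a), measureReal_level,
    measureReal_level] at h1
  linarith

theorem tendsto_height [IsFiniteMeasure μ] {ξ : ℕ → TowerPartition T.1} {β : ℝ} (hβ : 0 < β)
    (htower : Tendsto (fun j => μ.real (ξ j).tower) atTop (𝓝 β))
    (hbase : Tendsto (fun j => μ.real (ξ j).base) atTop (𝓝 0)) :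
    Tendsto (fun j => (ξ j).height) atTop atTop := by
  rw [tendsto_atTop]
  intro M
  have h1 : Tendsto (fun j => (M : ℝ) * μ.real (ξ j).base) atTop (𝓝 0) := by
    simpa using hbase.const_mul (M : ℝ)
  filter_upwards [h1.eventually_lt htower hβ] with j hj
  rw [measureReal_tower] at hj
  have := lt_of_mul_lt_mul_right hj measureReal_nonneg
  exact_mod_cast this.le

theorem tendsto_measureReal_top [IsFiniteMeasure μ] {ξ : ℕ → TowerPartition T.1} {β : ℝ}
    (htower : Tendsto (fun j => μ.real (ξ j).tower) atTop (𝓝 β))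
    (hbase : Tendsto (fun j => μ.real (ξ j).base) atTop (𝓝 0)) {q : ℕ} (hq : 0 < q) :
    Tendsto (fun j => μ.real ((ξ j).top ((ξ j).height - (ξ j).height / q))) atTop
      (𝓝 (β / q)) := by
  have hq' : (0 : ℝ) < q := by exact_mod_cast hq
  have hlo : Tendsto (fun j => μ.real (ξ j).tower / q - μ.real (ξ j).base) atTop
      (𝓝 (β / q)) := by
    simpa using (htower.div_const (q : ℝ)).sub hbase
  refine tendsto_of_tendsto_of_tendsto_of_le_of_le hlo (htower.div_const (q : ℝ))
    (fun j => ?_) (fun j => ?_)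
  all_goals
    have h0 : (ξ j).height / q ≤ (ξ j).height := Nat.div_le_self _ _
    have hw : 0 ≤ μ.real (ξ j).base := measureReal_nonneg
    simp only
    rw [measureReal_top, Nat.sub_sub_self h0, measureReal_tower, mul_div_right_comm]
  · have h1 : ((ξ j).height : ℝ) / q ≤ ((ξ j).height / q : ℕ) + 1 := by
      rw [div_le_iff₀ hq']
      have := Nat.div_add_mod (ξ j).height q
      have h2 := Nat.mod_lt (ξ j).height hq
      have h3 : (ξ j).height ≤ ((ξ j).height / q + 1) * q := by
        rw [add_mul, one_mul, mul_comm]; omega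
      exact_mod_cast h3
    have := mul_le_mul_of_nonneg_right h1 hw
    linarith
  · exact mul_le_mul_of_nonneg_right Nat.cast_div_le hw

end TowerPartition

end

/-! ### A pair of points at nearby levels of a tower -/

section

variable {X : Type*} [MeasurableSpace X] {μ : Measure X} {T : MPAut μ}

theorem iff_of_not_separated {a a' b b' c : Prop} (h1 : ¬((a ∧ ¬b) ∨ (b ∧ ¬a)))
    (h2 : ¬((a' ∧ ¬b') ∨ (b' ∧ ¬a'))) (h3 : ¬((b ∧ ¬c) ∨ (c ∧ ¬b)))
    (h4 : ¬((b' ∧ ¬c) ∨ (c ∧ ¬b'))) : a ↔ a' := by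
  tauto

theorem card_sub_le_card_filter {α ι : Type*} [Fintype ι] (s : Finset ℕ) (G : ℕ → Prop)
    [DecidablePred G] {F : ι → ℕ → Set α} {y : α} {c : ℝ}
    (hG : ∀ n ∈ s, ¬ G n → ∃ a, y ∈ F a n)
    (hF : ∀ a, ∑ n ∈ s, (F a n).indicator (fun _ => (1 : ℝ)) y ≤ c) :
    (s.card : ℝ) - Fintype.card ι * c ≤ (s.filter G).card := by
  have h1 : (s.card : ℝ) ≤ ∑ n ∈ s, ((if G n then (1 : ℝ) else 0) +
      ∑ a, (F a n).indicator (fun _ => (1 : ℝ)) y) := by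
    rw [Finset.card_eq_sum_ones, Nat.cast_sum, Nat.cast_one]
    refine Finset.sum_le_sum fun n hn => ?_
    have hnn : ∀ a, 0 ≤ (F a n).indicator (fun _ => (1 : ℝ)) y := fun a =>
      Set.indicator_nonneg (fun _ _ => zero_le_one) y
    split_ifs with h
    · exact le_add_of_nonneg_right (Finset.sum_nonneg fun a _ => hnn a)
    · obtain ⟨a, ha⟩ := hG n hn h
      rw [zero_add]
      refine (Set.indicator_of_mem ha fun _ => (1 : ℝ)).symm.le.trans ?_
      exact Finset.single_le_sum (f := fun a => (F a n).indicator (fun _ => (1 : ℝ)) y)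
        (fun a _ => hnn a) (Finset.mem_univ a)
  have h2 : ∑ a, ∑ n ∈ s, (F a n).indicator (fun _ => (1 : ℝ)) y ≤ Fintype.card ι * c := by
    refine (Finset.sum_le_sum fun a _ => hF a).trans (le_of_eq ?_)
    rw [Finset.sum_const, nsmul_eq_mul, Finset.card_univ]
  rw [Finset.sum_add_distrib, Finset.sum_boole, Finset.sum_comm] at h1
  linarith

namespace TowerPartition

set_option maxHeartbeats 400000 in
/-- For all late towers there are two points at distinct levels `p` and `p + m` of the top
`1/q`-part of the tower whose pasts, up to time `h - h/q`, are not distinguished by the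
sets of a given finite family, apart from a small proportion of the times. -/
theorem Approximates.eventually_exists_pair [StandardBorelSpace X] [IsProbabilityMeasure μ]
    (hT : Ergodic T.1 μ) (hatom : ∀ x, μ {x} = 0) {ξ : ℕ → TowerPartition T.1}
    (hξ : Approximates μ ξ) {β : ℝ} (hβ : 0 < β)
    (htower : Tendsto (fun j => μ.real (ξ j).tower) atTop (𝓝 β)) {S : MPAut μ}
    (hS : StatAsymptotic T S) (hS1 : μ {x | S.1 x ≠ x} ≠ 0) (𝒜 : Finset (Set X))
    (h𝒜 : ∀ A ∈ 𝒜, MeasurableSet A) (E : Set X → ℕ → Set X)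
    (hE : ∀ A ∈ 𝒜, ∀ j, (ξ j).Saturated (E A j))
    (hElim : ∀ A ∈ 𝒜, Tendsto (fun j => μ.real (E A j ∆ A)) atTop (𝓝 0))
    {q : ℕ} (hq : 2 ≤ q) {η : ℝ} (hη : 0 < η) :
    ∀ᶠ j in atTop, ∃ p m : ℕ, (ξ j).height - (ξ j).height / q ≤ p ∧ 1 ≤ m ∧
      p + m < (ξ j).height ∧ ∃ x ∈ (ξ j).level p, ∃ x' ∈ (ξ j).level (p + m), ∀ A ∈ 𝒜,
      ∃ s ⊆ Finset.Icc 1 ((ξ j).height - (ξ j).height / q),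
        (1 - 4 * η) * ((ξ j).height - (ξ j).height / q : ℕ) ≤ s.card ∧
        ∀ n ∈ s, ((T ^ n)⁻¹).1 x ∈ E A j ↔ ((T ^ n)⁻¹).1 x' ∈ E A j := by
  classical
  have hq0 : (0 : ℝ) < q := by exact_mod_cast (by omega : 0 < q)
  have hbase := hξ.tendsto_measureReal_base hatom hβ htower
  have hheight := tendsto_height hβ htower hbase
  set N : ℕ → ℕ := fun j => (ξ j).height - (ξ j).height / q with hN
  have hNlim : Tendsto N atTop atTop := by
    rw [tendsto_atTop]
    intro M
    filter_upwards [(tendsto_atTop.1 hheight) (2 * M)] with j hj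
    have : (ξ j).height / q ≤ (ξ j).height / 2 := Nat.div_le_div_left hq (by omega)
    simp only [hN]
    omega
  -- each image of `Y` meets the top part, of measure about `β / q`, in the proportion `β / q`, so
  -- `2 q / β` images make the parts of `Y` that are mapped to the top part overlap
  obtain ⟨K, hK⟩ := exists_nat_ge (2 * q / β)
  have hU : MeasurableSet {x | S.1 x ≠ x} :=
    (measurableSet_eq_fun (MPAut.measurable S) measurable_id).compl
  obtain ⟨k, Y, C, hYm, -, hY0, -, -, -, hpair⟩ := measure_ne_zero_separated_pairwise hS hS1 hU K
  set g : Fin K → MPAut μ := fun i => (T ^ k i)⁻¹ * S * T ^ k i with hg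
  have hgS : ∀ i, StatAsymptotic T (g i) := fun i => hS.conj (k i)
  have hYpos : 0 < μ.real Y :=
    lt_of_le_of_ne measureReal_nonneg fun h => hY0 ((measureReal_eq_zero_iff).1 h.symm)
  set V : ℕ → Fin K → Set X := fun j i => Y ∩ (g i).1 ⁻¹' (ξ j).top (N j) with hV
  have hVm : ∀ j i, MeasurableSet (V j i) := fun j i =>
    hYm.inter (MPAut.measurable _ ((ξ j).measurableSet_top _))
  have hVlim : Tendsto (fun j => ∑ i, μ.real (V j i)) atTop (𝓝 (K * (β / q * μ.real Y))) := by
    have h1 : ∀ i, Tendsto (fun j => μ.real (V j i)) atTop (𝓝 (β / q * μ.real Y)) := by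
      intro i
      have h2 := hT.tendsto_measureReal_inter (F := fun j => (ξ j).top (N j))
        (fun j => (ξ j).measurableSet_top _)
        (squeeze_zero (fun j => measureReal_nonneg)
          (fun j => (ξ j).measureReal_preimage_top_symmDiff_le (N j))
          (by simpa using hbase.const_mul (2 : ℝ)))
        (tendsto_measureReal_top htower hbase (by omega : 0 < q))
        (MPAut.measurable (g i)⁻¹ hYm)
      rw [MPAut.measureReal_preimage _ hYm] at h2
      refine h2.congr fun j => ?_
      have hm := ((ξ j).measurableSet_top (N j)).inter (MPAut.measurable (g i)⁻¹ hYm)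
      rw [← MPAut.measureReal_preimage (g i) hm, Set.preimage_inter]
      have : (g i).1 ⁻¹' ((g i)⁻¹.1 ⁻¹' Y) = Y := by
        ext y
        simp
      rw [this, Set.inter_comm]
    have h3 := tendsto_finsetSum Finset.univ fun i (_ : i ∈ Finset.univ) => h1 i
    simpa using h3
  have hlarge : 2 * μ.real Y ≤ K * (β / q * μ.real Y) := by
    rw [← mul_assoc]
    refine mul_le_mul_of_nonneg_right ?_ hYpos.le
    rw [div_le_iff₀ hβ] at hK
    rw [mul_div_assoc', le_div_iff₀ hq0]
    exact hK
  -- the exceptional points: those with an image whose past is too often in the error set of the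
  -- approximation (`Z1`), those that `A` separates too often from an image (`Z2`), and those with
  -- two distinct images in one level (`Z3`)
  set F : ℕ → Fin K → Set X → ℕ → Set X := fun j i A n =>
    ((T ^ n)⁻¹ * g i).1 ⁻¹' (E A j ∆ A) with hF
  set D : Fin K → Set X → ℕ → Set X := fun i A n =>
    (((T ^ n)⁻¹ * g i).1 ⁻¹' A) ∆ (((T ^ n)⁻¹).1 ⁻¹' A) with hD
  set Z1 : ℕ → Fin K → Set X → Set X := fun j i A => {y | η * N j <
    ∑ n ∈ Finset.Icc 1 (N j), (F j i A n).indicator (fun _ => (1 : ℝ)) y} with hZ1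
  set Z2 : ℕ → Fin K → Set X → Set X := fun j i A => {y | η * N j <
    ∑ n ∈ Finset.Icc 1 (N j), (D i A n).indicator (fun _ => (1 : ℝ)) y} with hZ2
  set Z3 : ℕ → Fin K → Fin K → Set X := fun j i l => {y | (g i).1 y ≠ (g l).1 y ∧
    ∃ k < (ξ j).height, (g i).1 y ∈ (ξ j).level k ∧ (g l).1 y ∈ (ξ j).level k} with hZ3
  have hZ1lim : ∀ i, ∀ A ∈ 𝒜, Tendsto (fun j => μ.real (Z1 j i A)) atTop (𝓝 0) := by
    intro i A hA
    have h1 : Tendsto (fun j => μ.real (E A j ∆ A) / η) atTop (𝓝 0) := by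
      simpa using (hElim A hA).div_const η
    refine squeeze_zero' (Eventually.of_forall fun j => measureReal_nonneg) ?_ h1
    filter_upwards [hNlim.eventually_gt_atTop 0] with j hj
    have hj' : (0 : ℝ) < N j := by exact_mod_cast hj
    have hEm := (hE A hA j).measurableSet.symmDiff (h𝒜 A hA)
    have h2 := measureReal_lt_sum_indicator_mul_le (μ := μ) (Finset.Icc 1 (N j))
      (F := F j i A) (fun n => MPAut.measurable _ hEm) (η * N j)
    rw [Finset.sum_congr rfl fun n _ => MPAut.measureReal_preimage _ hEm, Finset.sum_const,
      Nat.card_Icc, nsmul_eq_mul, Nat.add_sub_cancel] at h2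
    rw [le_div_iff₀ hη]
    refine le_of_mul_le_mul_left ?_ hj'
    calc _ = _ := by ring
      _ ≤ _ := h2
  have hZ2lim : ∀ i, ∀ A ∈ 𝒜, Tendsto (fun j => μ.real (Z2 j i A)) atTop (𝓝 0) := by
    intro i A hA
    have h1 := ((hgS i A (h𝒜 A hA)).comp hNlim).div_const η
    rw [zero_div] at h1
    refine squeeze_zero' (Eventually.of_forall fun j => measureReal_nonneg) ?_ h1
    filter_upwards [hNlim.eventually_gt_atTop 0] with j hj
    have hj' : (0 : ℝ) < N j := by exact_mod_cast hj
    have h2 := measureReal_lt_sum_indicator_mul_le (μ := μ) (Finset.Icc 1 (N j))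
      (F := D i A) (fun n => (MPAut.measurable _ (h𝒜 A hA)).symmDiff
        (MPAut.measurable _ (h𝒜 A hA))) (η * N j)
    rw [le_div_iff₀ hη]
    simp only [Function.comp]
    rw [le_inv_mul_iff₀ hj']
    calc _ = _ := by ring
      _ ≤ _ := h2
  have hZ3lim : ∀ i l, Tendsto (fun j => μ.real (Z3 j i l)) atTop (𝓝 0) := fun i l =>
    hξ.tendsto_sameLevel (MPAut.measurePreserving (g i)) (MPAut.measurePreserving (g l))
  set Z : ℕ → Set X := fun j => ⋃ i, ((⋃ A ∈ 𝒜, (Z1 j i A ∪ Z2 j i A)) ∪ ⋃ l, Z3 j i l) with hZ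
  have hZlim : Tendsto (fun j => (Fintype.card (Fin K)) * μ.real (Z j)) atTop (𝓝 0) := by
    have h1 : Tendsto (fun j => ∑ i, ((∑ A ∈ 𝒜, (μ.real (Z1 j i A) + μ.real (Z2 j i A))) +
        ∑ l, μ.real (Z3 j i l))) atTop (𝓝 0) := by
      have := tendsto_finsetSum Finset.univ fun i (_ : i ∈ (Finset.univ : Finset (Fin K))) =>
        (tendsto_finsetSum 𝒜 fun A hA => (hZ1lim i A hA).add (hZ2lim i A hA)).add
        (tendsto_finsetSum Finset.univ fun l (_ : l ∈ (Finset.univ : Finset (Fin K))) =>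
          hZ3lim i l)
      simpa using this
    have h2 : Tendsto (fun j => μ.real (Z j)) atTop (𝓝 0) := by
      refine squeeze_zero (fun j => measureReal_nonneg) (fun j => ?_) h1
      refine (measureReal_iUnion_fintype_le _).trans (Finset.sum_le_sum fun i _ => ?_)
      refine (measureReal_union_le _ _).trans (add_le_add ?_ (measureReal_iUnion_fintype_le _))
      exact (measureReal_biUnion_finset_le _ _).trans
        (Finset.sum_le_sum fun A _ => measureReal_union_le _ _)
    simpa using h2.const_mul (Fintype.card (Fin K) : ℝ)
  have hev := (hZlim.const_add (μ.real Y)).eventually_lt hVlim (by linarith)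
  filter_upwards [hev] with j hj
  obtain ⟨i, l, hil, y, hyi, hyl, hyZ⟩ :=
    exists_mem_inter_of_lt_sum_measureReal (hVm j) (fun i => Set.inter_subset_left) hj
  -- the points `g i y` and `g l y`, with the lower one first
  suffices h : ∀ i l : Fin K, y ∈ V j i → y ∈ V j l → ∀ p p', N j ≤ p → p < p' →
      p' < (ξ j).height → (g i).1 y ∈ (ξ j).level p → (g l).1 y ∈ (ξ j).level p' →
      ∃ p m : ℕ, N j ≤ p ∧ 1 ≤ m ∧ p + m < (ξ j).height ∧ ∃ x ∈ (ξ j).level p,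
        ∃ x' ∈ (ξ j).level (p + m), ∀ A ∈ 𝒜, ∃ s ⊆ Finset.Icc 1 (N j),
        (1 - 4 * η) * (N j : ℕ) ≤ s.card ∧
        ∀ n ∈ s, ((T ^ n)⁻¹).1 x ∈ E A j ↔ ((T ^ n)⁻¹).1 x' ∈ E A j by
    obtain ⟨p, hNp, hp, hxp⟩ := mem_top.1 hyi.2
    obtain ⟨p', hNp', hp', hxp'⟩ := mem_top.1 hyl.2
    rcases lt_trichotomy p p' with hlt | heq | hlt
    · exact h i l hyi hyl p p' hNp hlt hp' hxp hxp'
    · refine absurd (Set.mem_iUnion.2 ⟨i, Or.inr (Set.mem_iUnion.2 ⟨l, ?_⟩)⟩) hyZ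
      exact ⟨hpair y hyi.1 hil, p, hp, hxp, heq ▸ hxp'⟩
    · exact h l i hyl hyi p' p hNp' hlt hp hxp' hxp
  intro i l hyi hyl p p' hNp hlt hp' hxp hxp'
  refine ⟨p, p' - p, hNp, by omega, by omega, _, hxp, (g l).1 y, ?_, fun A hA => ?_⟩
  · rwa [show p + (p' - p) = p' by omega]
  have hnot : ∀ i, y ∉ Z1 j i A ∧ y ∉ Z2 j i A := by
    intro i
    constructor
    · exact fun h => hyZ (Set.mem_iUnion.2 ⟨i, Or.inl (Set.mem_biUnion hA (Or.inl h))⟩)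
    · exact fun h => hyZ (Set.mem_iUnion.2 ⟨i, Or.inl (Set.mem_biUnion hA (Or.inr h))⟩)
  refine ⟨(Finset.Icc 1 (N j)).filter fun n => ((T ^ n)⁻¹).1 ((g i).1 y) ∈ E A j ↔
    ((T ^ n)⁻¹).1 ((g l).1 y) ∈ E A j, Finset.filter_subset _ _, ?_,
    fun n hn => (Finset.mem_filter.1 hn).2⟩
  have hcount := card_sub_le_card_filter (Finset.Icc 1 (N j))
    (fun n => ((T ^ n)⁻¹).1 ((g i).1 y) ∈ E A j ↔ ((T ^ n)⁻¹).1 ((g l).1 y) ∈ E A j)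
    (F := ![F j i A, F j l A, D i A, D l A]) (y := y) (c := η * N j) (fun n _ hn => ?_)
    (fun a => ?_)
  · rw [Nat.card_Icc, Nat.add_sub_cancel] at hcount
    refine le_trans (le_of_eq ?_) hcount
    rw [Fintype.card_fin]
    push_cast
    ring
  · by_contra hcon
    push Not at hcon
    have c1 : y ∉ F j i A n := hcon 0
    have c2 : y ∉ F j l A n := hcon 1
    have c3 : y ∉ D i A n := hcon 2
    have c4 : y ∉ D l A n := hcon 3
    exact hn (iff_of_not_separated c1 c2 c3 c4)
  · fin_cases a
    · exact not_lt.1 (hnot i).1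
    · exact not_lt.1 (hnot l).1
    · exact not_lt.1 (hnot i).2
    · exact not_lt.1 (hnot l).2

end TowerPartition

/-- If a nontrivial `S` is statistically asymptotic to the identity along `T`, some power `Tᵐ` with
`m ≥ 1` keeps nearly the fraction `β` of each intersection of finitely many given sets in place. -/
theorem exists_shift_of_statAsymptotic [StandardBorelSpace X] [IsProbabilityMeasure μ]
    (hT : Ergodic T.1 μ) (hatom : ∀ x, μ {x} = 0) {β : ℝ} (hβ : 0 < β)
    (htow : HasTowers μ T.1 β) {S : MPAut μ} (hS : StatAsymptotic T S)
    (hS1 : μ {x | S.1 x ≠ x} ≠ 0) (𝒜 : Finset (Set X)) (h𝒜 : ∀ A ∈ 𝒜, MeasurableSet A)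
    {ε : ℝ} (hε : 0 < ε) :
    ∃ m, 1 ≤ m ∧ ∀ A ∈ 𝒜, ∀ B ∈ 𝒜,
      β * μ.real (A ∩ B) - ε ≤ μ.real ((T ^ m).1 ⁻¹' A ∩ B) := by
  classical
  obtain ⟨ξ, hξ, htower⟩ := htow.exists_approximates
  have hex : ∀ A : Set X, ∃ E : ℕ → Set X, A ∈ 𝒜 → (∀ j, (ξ j).Saturated (E j)) ∧
      Tendsto (fun j => μ.real (E j ∆ A)) atTop (𝓝 0) := by
    intro A
    by_cases hA : A ∈ 𝒜
    · obtain ⟨E, h⟩ := hξ A (h𝒜 A hA)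
      exact ⟨E, fun _ => h⟩
    · exact ⟨fun _ => ∅, fun h => absurd h hA⟩
  choose E hE using hex
  have hbase := hξ.tendsto_measureReal_base hatom hβ htower
  obtain ⟨q, hq⟩ := exists_nat_ge (max 2 (4 / ε))
  have hq2 : 2 ≤ q := by exact_mod_cast (le_max_left _ _).trans hq
  have hq0 : (0 : ℝ) < q := by exact_mod_cast (by omega : 0 < q)
  have hqε : 1 / (q : ℝ) ≤ ε / 4 := by
    have := (le_max_right _ _).trans hq
    rw [div_le_iff₀ hε] at this
    rw [div_le_iff₀ hq0]
    linarith
  have hev1 := hξ.eventually_exists_pair hT hatom hβ htower hS hS1 𝒜 h𝒜 E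
    (fun A hA => (hE A hA).1) (fun A hA => (hE A hA).2) hq2 (η := ε / 16) (by positivity)
  have hev2 : ∀ᶠ j in atTop, ∀ A ∈ 𝒜, μ.real (E A j ∆ A) < ε / 8 := by
    rw [Filter.eventually_all_finset]
    exact fun A hA => (hE A hA).2.eventually (gt_mem_nhds (by positivity))
  have hev3 : ∀ᶠ j in atTop, ∀ A ∈ 𝒜, ∀ B ∈ 𝒜,
      β * μ.real (A ∩ B) - ε / 4 < μ.real ((ξ j).tower ∩ (A ∩ B)) := by
    rw [Filter.eventually_all_finset]
    intro A hA
    rw [Filter.eventually_all_finset]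
    intro B hB
    have htop : ∀ j, (ξ j).tower = (ξ j).top 0 := by
      intro j
      rw [TowerPartition.tower_eq, Finset.range_eq_Ico]
      rfl
    have := hT.tendsto_measureReal_inter (F := fun j => (ξ j).tower)
      (fun j => (ξ j).measurableSet_tower)
      (squeeze_zero (fun j => measureReal_nonneg)
          (fun j => by
            simpa only [htop] using (ξ j).measureReal_preimage_top_symmDiff_le 0)
          (by simpa using hbase.const_mul (2 : ℝ))) htower ((h𝒜 A hA).inter (h𝒜 B hB))
    exact this.eventually (lt_mem_nhds (by linarith))
  obtain ⟨j, ⟨p, m, hNp, hm, hpm, x, hx, x', hx', hs⟩, hj2, hj3⟩ :=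
    (hev1.and (hev2.and hev3)).exists
  refine ⟨m, hm, fun A hA B hB => ?_⟩
  obtain ⟨s, hsN, hscard, hgood⟩ := hs A hA
  have hmain := TowerPartition.measureReal_tower_inter_le (B := B) (h𝒜 A hA) ((hE A hA).1 j) hNp
    hpm hx hx' hsN hgood
  have h2 := hj2 A hA
  have h3 := hj3 A hA B hB
  have hone : ((ξ j).height : ℝ) * μ.real (ξ j).base ≤ 1 := by
    rw [← TowerPartition.measureReal_tower]
    exact measureReal_le_one
  have hw : 0 ≤ μ.real (ξ j).base := measureReal_nonneg
  have hcard : ((ξ j).height : ℝ) - s.card ≤ ε / 2 * (ξ j).height := by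
    have h4 : (ξ j).height / q ≤ (ξ j).height := Nat.div_le_self _ _
    rw [Nat.cast_sub h4] at hscard
    have h5 : (((ξ j).height / q : ℕ) : ℝ) ≤ ε / 4 * (ξ j).height := by
      refine Nat.cast_div_le.trans ?_
      rw [div_eq_mul_one_div, mul_comm]
      exact mul_le_mul_of_nonneg_right hqε (Nat.cast_nonneg _)
    have h6 : (0 : ℝ) ≤ ((ξ j).height / q : ℕ) := Nat.cast_nonneg _
    have h7 : 0 ≤ ε / 4 * (((ξ j).height / q : ℕ) : ℝ) := by positivity
    nlinarith
  have hfin : ((ξ j).height - s.card) * μ.real (ξ j).base ≤ ε / 2 := by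
    have := mul_le_mul_of_nonneg_right hcard hw
    have h8 := mul_le_mul_of_nonneg_left hone (by positivity : 0 ≤ ε / 2)
    linarith
  linarith

end

/-! ### Weak operator limits and positivity on `L²` -/

section

/-- Contractions of a Hilbert space converge in the weak operator topology along an ultrafilter. -/
theorem exists_ultrafilter_wot_limit {H : Type*} [NormedAddCommGroup H] [InnerProductSpace ℝ H]
    [CompleteSpace H] {ι : Type*} (l : Ultrafilter ι) {U : ι → H →L[ℝ] H}
    (hU : ∀ i f, ‖U i f‖ ≤ ‖f‖) :
    ∃ P : H →L[ℝ] H, ∀ f g, Tendsto (fun i => inner ℝ (U i f) g) l (𝓝 (inner ℝ (P f) g)) := by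
  have hex : ∀ f g : H, ∃ c : ℝ, |c| ≤ ‖f‖ * ‖g‖ ∧
      Tendsto (fun i => inner ℝ (U i f) g) l (𝓝 c) := by
    intro f g
    have hmem : ∀ i, inner ℝ (U i f) g ∈ Set.Icc (-(‖f‖ * ‖g‖)) (‖f‖ * ‖g‖) := fun i =>
      abs_le.1 ((abs_real_inner_le_norm _ _).trans
        (mul_le_mul_of_nonneg_right (hU i f) (norm_nonneg g)))
    obtain ⟨c, hc, hlim⟩ := (isCompact_Icc (a := -(‖f‖ * ‖g‖)) (b := ‖f‖ * ‖g‖)).ultrafilter_le_nhds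
      (l.map fun i => inner ℝ (U i f) g)
      (le_principal_iff.2 (mem_map.2 (Eventually.of_forall hmem)))
    exact ⟨c, abs_le.2 hc, hlim⟩
  choose L hL hlim using hex
  have hadd_right : ∀ f g h, L f (g + h) = L f g + L f h := fun f g h =>
    tendsto_nhds_unique (hlim f (g + h))
      (((hlim f g).add (hlim f h)).congr fun i => (inner_add_right _ _ _).symm)
  have hsmul_right : ∀ (c : ℝ) f g, L f (c • g) = c * L f g := fun c f g =>
    tendsto_nhds_unique (hlim f (c • g))
      (((hlim f g).const_mul c).congr fun i => (real_inner_smul_right _ _ _).symm)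
  have hadd_left : ∀ f g h, L (f + g) h = L f h + L g h := fun f g h =>
    tendsto_nhds_unique (hlim (f + g) h)
      (((hlim f h).add (hlim g h)).congr fun i => by rw [map_add, inner_add_left])
  have hsmul_left : ∀ (c : ℝ) f g, L (c • f) g = c * L f g := fun c f g =>
    tendsto_nhds_unique (hlim (c • f) g)
      (((hlim f g).const_mul c).congr fun i => by rw [map_smul, real_inner_smul_left])
  let D : H → H →L[ℝ] ℝ := fun f => LinearMap.mkContinuous
    { toFun := L f, map_add' := hadd_right f, map_smul' := fun c g => hsmul_right c f g } ‖f‖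
    fun g => hL f g
  let p : H → H := fun f => (InnerProductSpace.toDual ℝ H).symm (D f)
  have hp : ∀ f g, inner ℝ (p f) g = L f g := fun f g =>
    InnerProductSpace.toDual_symm_apply
  refine ⟨LinearMap.mkContinuous
    { toFun := p, map_add' := fun f g => ?_, map_smul' := fun c f => ?_ } 1 fun f => ?_, ?_⟩
  · refine ext_inner_right ℝ fun v => ?_
    rw [inner_add_left, hp, hp, hp, hadd_left]
  · refine ext_inner_right ℝ fun v => ?_
    rw [RingHom.id_apply, real_inner_smul_left, hp, hp, hsmul_left]
  · change ‖(InnerProductSpace.toDual ℝ H).symm (D f)‖ ≤ 1 * ‖f‖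
    rw [LinearIsometryEquiv.norm_map, one_mul]
    exact LinearMap.mkContinuous_norm_le _ (norm_nonneg f) _
  · intro f g
    change Tendsto _ _ (𝓝 (inner ℝ (p f) g))
    rw [hp]
    exact hlim f g

theorem tendsto_of_denseRange_of_lipschitz {E : Type*} [SeminormedAddCommGroup E] {d : ℕ → E}
    (hd : DenseRange d) {φ : ℕ → E → ℝ} {ψ : E → ℝ} {C : ℝ}
    (hφ : ∀ k x y, |φ k x - φ k y| ≤ C * ‖x - y‖) (hψ : ∀ x y, |ψ x - ψ y| ≤ C * ‖x - y‖)
    (h : ∀ a, Tendsto (fun k => φ k (d a)) atTop (𝓝 (ψ (d a)))) (x : E) :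
    Tendsto (fun k => φ k x) atTop (𝓝 (ψ x)) := by
  rw [Metric.tendsto_nhds]
  intro ε hε
  obtain ⟨a, ha⟩ := hd.exists_dist_lt x (ε := ε / (3 * (|C| + 1))) (by positivity)
  have hC : C * ‖x - d a‖ ≤ ε / 3 := by
    rw [dist_eq_norm, lt_div_iff₀ (by positivity)] at ha
    have h1 := mul_le_mul_of_nonneg_right (le_abs_self C) (norm_nonneg (x - d a))
    have h2 := norm_nonneg (x - d a)
    linarith
  filter_upwards [Metric.tendsto_nhds.1 (h a) (ε / 3) (by positivity)] with k hk
  rw [Real.dist_eq] at hk ⊢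
  have h1 := (hφ k x (d a)).trans hC
  have h2 := (hψ x (d a)).trans hC
  rw [abs_le] at h1 h2
  rw [abs_lt] at hk ⊢
  constructor <;> linarith [h1.1, h1.2, h2.1, h2.2, hk.1, hk.2]

/-- On a separable Hilbert space, a limit of contractions in the weak operator topology along a
filter is the limit of a sequence of them, which may be chosen with given eventual properties. -/
theorem exists_seq_wot_limit {H : Type*} [NormedAddCommGroup H] [InnerProductSpace ℝ H]
    [TopologicalSpace.SeparableSpace H] {ι : Type*} {l : Filter ι} [l.NeBot]
    {U : ι → H →L[ℝ] H} (hU : ∀ i f, ‖U i f‖ ≤ ‖f‖) {P : H →L[ℝ] H}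
    (hP : ∀ f g, Tendsto (fun i => inner ℝ (U i f) g) l (𝓝 (inner ℝ (P f) g)))
    {Q : ℕ → ι → Prop} (hQ : ∀ k, ∀ᶠ i in l, Q k i) :
    ∃ i : ℕ → ι, (∀ k, Q k (i k)) ∧
      ∀ f g, Tendsto (fun k => inner ℝ (U (i k) f) g) atTop (𝓝 (inner ℝ (P f) g)) := by
  have : Nonempty H := ⟨0⟩
  set d := TopologicalSpace.denseSeq H
  have hd : DenseRange d := TopologicalSpace.denseRange_denseSeq H
  have hex : ∀ k : ℕ, ∃ i, Q k i ∧ ∀ a ∈ Finset.range k, ∀ b ∈ Finset.range k,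
      dist (inner ℝ (U i (d a)) (d b)) (inner ℝ (P (d a)) (d b)) < 1 / ((k : ℝ) + 1) := by
    intro k
    refine ((hQ k).and ?_).exists
    rw [Filter.eventually_all_finset]
    intro a _
    rw [Filter.eventually_all_finset]
    intro b _
    exact Metric.tendsto_nhds.1 (hP (d a) (d b)) _ (by positivity)
  choose i hi hclose using hex
  refine ⟨i, hi, ?_⟩
  have h1 : ∀ a b, Tendsto (fun k => inner ℝ (U (i k) (d a)) (d b)) atTop
      (𝓝 (inner ℝ (P (d a)) (d b))) := by
    intro a b
    rw [tendsto_iff_dist_tendsto_zero]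
    refine squeeze_zero' (Eventually.of_forall fun k => dist_nonneg) ?_
      tendsto_one_div_add_atTop_nhds_zero_nat
    filter_upwards [eventually_gt_atTop a, eventually_gt_atTop b] with k ha hb
    exact (hclose k a (Finset.mem_range.2 ha) b (Finset.mem_range.2 hb)).le
  have hnorm : ∀ f, ‖P f‖ ≤ ‖P‖ * ‖f‖ := P.le_opNorm
  have h2 : ∀ f b, Tendsto (fun k => inner ℝ (U (i k) f) (d b)) atTop
      (𝓝 (inner ℝ (P f) (d b))) := by
    intro f b
    refine tendsto_of_denseRange_of_lipschitz (C := (1 + ‖P‖) * ‖d b‖) hd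
      (φ := fun k f => inner ℝ (U (i k) f) (d b)) (ψ := fun f => inner ℝ (P f) (d b))
      (fun k x y => ?_) (fun x y => ?_) (fun a => h1 a b) f
    · rw [← inner_sub_left, ← map_sub]
      refine (abs_real_inner_le_norm _ _).trans ?_
      have h3 := mul_le_mul_of_nonneg_right (hU (i k) (x - y)) (norm_nonneg (d b))
      have h4 : 0 ≤ ‖P‖ * ‖d b‖ * ‖x - y‖ := by positivity
      linarith
    · rw [← inner_sub_left, ← map_sub]
      refine (abs_real_inner_le_norm _ _).trans ?_
      have h3 := mul_le_mul_of_nonneg_right (hnorm (x - y)) (norm_nonneg (d b))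
      have h4 : 0 ≤ ‖d b‖ * ‖x - y‖ := by positivity
      linarith
  intro f g
  refine tendsto_of_denseRange_of_lipschitz (C := (1 + ‖P‖) * ‖f‖) hd
    (φ := fun k g => inner ℝ (U (i k) f) g) (ψ := fun g => inner ℝ (P f) g)
    (fun k x y => ?_) (fun x y => ?_) (fun b => h2 f b) g
  · rw [← inner_sub_right]
    refine (abs_real_inner_le_norm _ _).trans ?_
    have h3 := mul_le_mul_of_nonneg_right (hU (i k) f) (norm_nonneg (x - y))
    have h4 : 0 ≤ ‖P‖ * ‖f‖ * ‖x - y‖ := by positivity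
    linarith
  · rw [← inner_sub_right]
    refine (abs_real_inner_le_norm _ _).trans ?_
    have h3 := mul_le_mul_of_nonneg_right (hnorm f) (norm_nonneg (x - y))
    have h4 : 0 ≤ ‖f‖ * ‖x - y‖ := by positivity
    linarith

variable {X : Type*} [MeasurableSpace X] {μ : Measure X}

theorem inner_indL2_eq_setIntegral [IsFiniteMeasure μ] (f : Lp ℝ 2 μ) {B : Set X}
    (hB : MeasurableSet B) : inner ℝ f (indL2 μ hB) = ∫ x in B, f x ∂μ := by
  rw [real_inner_comm]
  exact L2.inner_indicatorConstLp_one hB (measure_ne_top μ B) f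

theorem inner_indL2_univ [IsFiniteMeasure μ] (f : Lp ℝ 2 μ) :
    inner ℝ f (indL2 μ MeasurableSet.univ) = ∫ x, f x ∂μ := by
  rw [inner_indL2_eq_setIntegral, setIntegral_univ]

theorem integrable_coe_Lp_two [IsFiniteMeasure μ] (f : Lp ℝ 2 μ) : Integrable f μ :=
  (Lp.memLp f).integrable one_le_two

theorem Lp_nonneg_of_inner_indL2_nonneg [IsFiniteMeasure μ] {f : Lp ℝ 2 μ}
    (h : ∀ (B : Set X) (hB : MeasurableSet B), 0 ≤ inner ℝ f (indL2 μ hB)) : 0 ≤ f := by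
  rw [← Lp.coeFn_nonneg]
  refine ae_nonneg_of_forall_setIntegral_nonneg (integrable_coe_Lp_two f) fun B hB _ => ?_
  rw [← inner_indL2_eq_setIntegral f hB]
  exact h B hB

theorem Lp_inner_nonneg {f g : Lp ℝ 2 μ} (hf : 0 ≤ f) (hg : 0 ≤ g) : 0 ≤ inner ℝ f g := by
  rw [L2.inner_def]
  refine integral_nonneg_of_ae ?_
  filter_upwards [(Lp.coeFn_nonneg f).2 hf, (Lp.coeFn_nonneg g).2 hg] with x h1 h2
  simpa using mul_nonneg h2 h1

theorem Lp_const_one_eq [IsFiniteMeasure μ] :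
    Lp.const 2 μ (1 : ℝ) = indL2 μ MeasurableSet.univ :=
  (indicatorConstLp_univ (p := 2) (μ := μ) (c := (1 : ℝ))).symm

/-- An operator on `L²` with nonnegative matrix coefficients at indicator functions is positive:
its adjoint maps each indicator function to a function with nonnegative integrals over sets. -/
theorem map_nonneg_of_inner_indL2_nonneg [IsFiniteMeasure μ] {P : Lp ℝ 2 μ →L[ℝ] Lp ℝ 2 μ}
    (h : ∀ (A B : Set X) (hA : MeasurableSet A) (hB : MeasurableSet B),
      0 ≤ inner ℝ (P (indL2 μ hA)) (indL2 μ hB)) {f : Lp ℝ 2 μ} (hf : 0 ≤ f) : 0 ≤ P f := by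
  refine Lp_nonneg_of_inner_indL2_nonneg fun B hB => ?_
  rw [← ContinuousLinearMap.adjoint_inner_right]
  refine Lp_inner_nonneg hf (Lp_nonneg_of_inner_indL2_nonneg fun A hA => ?_)
  rw [ContinuousLinearMap.adjoint_inner_left, real_inner_comm]
  exact h A B hA hB

end

/-! ### Partial rigidity from shifts -/

section

variable {X : Type*} [MeasurableSpace X] {μ : Measure X}

theorem Lp_eq_zero_of_inner_indL2_eq_zero [IsFiniteMeasure μ] {f : Lp ℝ 2 μ}
    (h : ∀ (B : Set X) (hB : MeasurableSet B), inner ℝ f (indL2 μ hB) = 0) : f = 0 := by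
  refine le_antisymm ?_ (Lp_nonneg_of_inner_indL2_nonneg fun B hB => (h B hB).ge)
  rw [← neg_nonneg]
  refine Lp_nonneg_of_inner_indL2_nonneg fun B hB => ?_
  rw [inner_neg_left, h B hB, neg_zero]

theorem inner_indL2_add_compl [IsFiniteMeasure μ] (f : Lp ℝ 2 μ) {B : Set X}
    (hB : MeasurableSet B) : inner ℝ f (indL2 μ hB) + inner ℝ f (indL2 μ hB.compl) =
      ∫ x, f x ∂μ := by
  rw [inner_indL2_eq_setIntegral, inner_indL2_eq_setIntegral,
    integral_add_compl hB (integrable_coe_Lp_two f)]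

theorem koopman_one [IsFiniteMeasure μ] (g : AutGroup μ) :
    koopman μ g (indL2 μ MeasurableSet.univ) = indL2 μ MeasurableSet.univ := by
  induction g using QuotientGroup.induction_on with
  | H g => exact koopman_indL2 g MeasurableSet.univ

theorem integral_koopman [IsFiniteMeasure μ] (g : AutGroup μ) (f : Lp ℝ 2 μ) :
    inner ℝ (koopman μ g f) (indL2 μ MeasurableSet.univ) =
      inner ℝ f (indL2 μ MeasurableSet.univ) := by
  conv_lhs => rw [← koopman_one g]
  exact inner_koopman_koopman g f _

/-- An operator that preserves `1` and the integral and dominates `β I` is a convex combination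
of the identity and a Markov operator. -/
theorem exists_isMarkovOperator [IsFiniteMeasure μ] {P : Lp ℝ 2 μ →L[ℝ] Lp ℝ 2 μ} {β : ℝ}
    (hβ : β ≤ 1) (hP1 : P (indL2 μ MeasurableSet.univ) = indL2 μ MeasurableSet.univ)
    (hPint : ∀ f, inner ℝ (P f) (indL2 μ MeasurableSet.univ) =
      inner ℝ f (indL2 μ MeasurableSet.univ))
    (hPβ : ∀ (A B : Set X) (hA : MeasurableSet A) (hB : MeasurableSet B),
      β * inner ℝ (indL2 μ hA) (indL2 μ hB) ≤ inner ℝ (P (indL2 μ hA)) (indL2 μ hB)) :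
    ∃ M, IsMarkovOperator μ M ∧ ∀ f, P f = β • f + (1 - β) • M f := by
  set Q : Lp ℝ 2 μ →L[ℝ] Lp ℝ 2 μ := P - β • ContinuousLinearMap.id ℝ _ with hQ
  have hQf : ∀ f, Q f = P f - β • f := fun f => rfl
  have hQpos : ∀ (A B : Set X) (hA : MeasurableSet A) (hB : MeasurableSet B),
      0 ≤ inner ℝ (Q (indL2 μ hA)) (indL2 μ hB) := by
    intro A B hA hB
    rw [hQf, inner_sub_left, real_inner_smul_left, sub_nonneg]
    exact hPβ A B hA hB
  have hQint : ∀ f, inner ℝ (Q f) (indL2 μ MeasurableSet.univ) =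
      (1 - β) * inner ℝ f (indL2 μ MeasurableSet.univ) := by
    intro f
    rw [hQf, inner_sub_left, real_inner_smul_left, hPint]
    ring
  rcases hβ.lt_or_eq with hlt | rfl
  · have hpos : 0 < 1 - β := sub_pos.2 hlt
    refine ⟨(1 - β)⁻¹ • Q, ⟨fun f hf => ?_, ?_, fun f => ?_⟩, fun f => ?_⟩
    · refine map_nonneg_of_inner_indL2_nonneg (fun A B hA hB => ?_) hf
      rw [smul_apply, real_inner_smul_left]
      exact mul_nonneg (inv_nonneg.2 hpos.le) (hQpos A B hA hB)
    · rw [Lp_const_one_eq, smul_apply, hQf, hP1]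
      nth_rewrite 1 [← one_smul ℝ (indL2 μ MeasurableSet.univ)]
      rw [← sub_smul, smul_smul, inv_mul_cancel₀ hpos.ne', one_smul]
    · rw [← inner_indL2_univ, ← inner_indL2_univ, smul_apply,
        real_inner_smul_left, hQint, inv_mul_cancel_left₀ hpos.ne']
    · rw [smul_apply, smul_smul, mul_inv_cancel₀ hpos.ne', one_smul, hQf]
      abel
  · -- for `β = 1` a positive operator that annihilates integrals vanishes
    refine ⟨ContinuousLinearMap.id ℝ _, ⟨fun f hf => hf, rfl, fun f => rfl⟩, fun f => ?_⟩
    have hzero : ∀ (A B : Set X) (hA : MeasurableSet A) (hB : MeasurableSet B),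
        inner ℝ (Q (indL2 μ hA)) (indL2 μ hB) = 0 := by
      intro A B hA hB
      have h1 := inner_indL2_add_compl (Q (indL2 μ hA)) hB
      rw [← inner_indL2_univ, hQint, sub_self, zero_mul] at h1
      linarith [hQpos A B hA hB, hQpos A Bᶜ hA hB.compl]
    have hQ0 : Q f = 0 := by
      refine Lp_eq_zero_of_inner_indL2_eq_zero fun B hB => ?_
      rw [← ContinuousLinearMap.adjoint_inner_right,
        Lp_eq_zero_of_inner_indL2_eq_zero (f := ContinuousLinearMap.adjoint Q (indL2 μ hB)),
        inner_zero_right]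
      intro A hA
      rw [ContinuousLinearMap.adjoint_inner_left, real_inner_comm]
      exact hzero A B hA hB
    rw [hQf, sub_eq_zero] at hQ0
    rw [hQ0, sub_self, zero_smul, add_zero]

/-- The weak limit is taken along an ultrafilter on the pairs of a finite family of sets and a
natural number, so that it satisfies the inequality for all sets at once. -/
theorem isPartiallyRigid_of_shifts [StandardBorelSpace X] [IsFiniteMeasure μ] {T : MPAut μ}
    {β : ℝ} (hβ : β ≤ 1)
    (h : ∀ (𝒜 : Finset {A : Set X // MeasurableSet A}) (k : ℕ), ∃ m, k ≤ m ∧ ∀ A ∈ 𝒜, ∀ B ∈ 𝒜,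
      β * μ.real (A.1 ∩ B.1) - 1 / ((k : ℝ) + 1) ≤ μ.real ((T ^ m).1 ⁻¹' A.1 ∩ B.1)) :
    IsPartiallyRigid (T : AutGroup μ) β := by
  choose m hm hshift using h
  set l : Ultrafilter (Finset {A : Set X // MeasurableSet A} × ℕ) := Ultrafilter.of atTop
  have hl : (l : Filter (Finset {A : Set X // MeasurableSet A} × ℕ)) ≤ atTop :=
    Ultrafilter.of_le atTop
  set U : Finset {A : Set X // MeasurableSet A} × ℕ → Lp ℝ 2 μ →L[ℝ] Lp ℝ 2 μ :=
    fun i => koopman μ ((T : AutGroup μ) ^ m i.1 i.2) with hU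
  have hUn : ∀ i f, ‖U i f‖ ≤ ‖f‖ := fun i f => (norm_koopman _ f).le
  obtain ⟨P, hP⟩ := exists_ultrafilter_wot_limit l hUn
  have hP1 : P (indL2 μ MeasurableSet.univ) = indL2 μ MeasurableSet.univ := by
    refine ext_inner_right ℝ fun v => tendsto_nhds_unique (hP _ v) ?_
    simp only [hU, koopman_one]
    exact tendsto_const_nhds
  have hPint : ∀ f, inner ℝ (P f) (indL2 μ MeasurableSet.univ) =
      inner ℝ f (indL2 μ MeasurableSet.univ) := by
    intro f
    refine tendsto_nhds_unique (hP f _) ?_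
    simp only [hU, integral_koopman]
    exact tendsto_const_nhds
  have hsnd : Tendsto (fun i : Finset {A : Set X // MeasurableSet A} × ℕ => i.2) l atTop :=
    (tendsto_snd.mono_left (prod_atTop_atTop_eq.symm.le)).mono_left hl
  have hPβ : ∀ (A B : Set X) (hA : MeasurableSet A) (hB : MeasurableSet B),
      β * inner ℝ (indL2 μ hA) (indL2 μ hB) ≤ inner ℝ (P (indL2 μ hA)) (indL2 μ hB) := by
    intro A B hA hB
    have h1 : Tendsto (fun i : Finset {A : Set X // MeasurableSet A} × ℕ =>
        β * μ.real (B ∩ A) - 1 / ((i.2 : ℝ) + 1)) l (𝓝 (β * μ.real (B ∩ A) - 0)) :=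
      (tendsto_one_div_add_atTop_nhds_zero_nat.comp hsnd).const_sub _
    rw [inner_indL2, Set.inter_comm, ← sub_zero (β * _)]
    refine le_of_tendsto_of_tendsto h1 (hP _ _) ?_
    classical
    filter_upwards [hl (eventually_ge_atTop (({⟨A, hA⟩, ⟨B, hB⟩}, 0) :
      Finset {A : Set X // MeasurableSet A} × ℕ))] with i hi
    have h2 := hshift i.1 i.2 ⟨B, hB⟩ (hi.1 (by simp)) ⟨A, hA⟩ (hi.1 (by simp))
    refine h2.trans (le_of_eq ?_)
    have h3 : inner ℝ (U i (indL2 μ hA)) (indL2 μ hB) =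
        inner ℝ (indL2 μ hA) (indL2 μ (MPAut.measurable (T ^ m i.1 i.2) hB)) := by
      rw [← inner_koopman_koopman (((T ^ m i.1 i.2)⁻¹ : MPAut μ) : AutGroup μ)
        (U i (indL2 μ hA)), koopman_inv_indL2]
      congr 1
      simp only [hU]
      rw [← mul_apply_eq_comp, ← map_mul, QuotientGroup.mk_inv, QuotientGroup.mk_pow,
        inv_mul_cancel, map_one]
      rfl
    rw [h3, inner_indL2, Set.inter_comm]
  obtain ⟨M, hM, hPM⟩ := exists_isMarkovOperator hβ hP1 hPint hPβ
  have : Fact ((2 : ℝ≥0∞) ≠ ∞) := ⟨ENNReal.ofNat_ne_top⟩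
  obtain ⟨i, hi, hlim⟩ := exists_seq_wot_limit hUn hP (Q := fun k i => k ≤ i.2)
    fun k => hsnd.eventually_ge_atTop k
  refine ⟨fun k => m (i k).1 (i k).2, ?_, M, hM, fun f g => ?_⟩
  · exact tendsto_atTop_mono (fun k => (hi k).trans (hm _ _)) tendsto_id
  · rw [← hPM]
    exact hlim f g

theorem isPartiallyRigid_of_pow_eq_one [IsFiniteMeasure μ] {T : AutGroup μ} {r : ℕ} (hr : 0 < r)
    (h : T ^ r = 1) (β : ℝ) : IsPartiallyRigid T β := by
  refine ⟨fun k => r * k, tendsto_id.const_mul_atTop' hr, ContinuousLinearMap.id ℝ _,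
    ⟨fun f hf => hf, rfl, fun f => rfl⟩, fun f g => ?_⟩
  have h1 : β • f + (1 - β) • f = f := by rw [← add_smul, add_sub_cancel, one_smul]
  simp only [pow_mul, h, one_pow, map_one, ContinuousLinearMap.id_apply, h1]
  exact tendsto_const_nhds

theorem IsPartiallyRigid.isRigid [IsFiniteMeasure μ] {T : AutGroup μ}
    (h : IsPartiallyRigid T 1) : IsRigid T := by
  obtain ⟨n, hn, M, -, hlim⟩ := h
  refine ⟨n, hn, fun f => ?_⟩
  have h1 := hlim f f
  rw [one_smul, sub_self, zero_smul, add_zero] at h1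
  rw [tendsto_iff_norm_sub_tendsto_zero]
  have h2 : Tendsto (fun i => ‖koopman μ (T ^ n i) f - f‖ ^ 2) atTop (𝓝 0) := by
    have h3 := (h1.const_mul 2).const_sub (2 * ‖f‖ ^ 2)
    rw [real_inner_self_eq_norm_sq, sub_self] at h3
    refine h3.congr fun i => ?_
    rw [norm_sub_sq_real, norm_koopman]
    ring
  have := h2.sqrt
  simpa [Real.sqrt_sq (norm_nonneg _)] using this

end

/-! ### Atoms, ergodicity of rank one, and the choice of the shifts -/

section

variable {X : Type*} [MeasurableSpace X] {μ : Measure X} {T : MPAut μ}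

/-- By recurrence an atom is periodic, and the points of its period form an invariant set. -/
theorem Ergodic.exists_pow_eq_one_of_atom [StandardBorelSpace X] [IsProbabilityMeasure μ]
    (hT : Ergodic T.1 μ) {x₀ : X} (hx₀ : μ {x₀} ≠ 0) :
    ∃ r, 0 < r ∧ (T : AutGroup μ) ^ r = 1 := by
  obtain ⟨y, rfl, r, hr, hy⟩ := hT.toMeasurePreserving.exists_mem_iterate_mem
    (measurableSet_singleton x₀).nullMeasurableSet hx₀
  refine ⟨r, Nat.pos_of_ne_zero hr, ?_⟩
  have hm : MeasurableSet {x | T.1^[r] x = x} :=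
    measurableSet_eq_fun ((MPAut.measurable T).iterate r) measurable_id
  have hinv : T.1 ⁻¹' {x | T.1^[r] x = x} = {x | T.1^[r] x = x} := by
    ext x
    rw [Set.mem_preimage, Set.mem_ofPred_eq, Set.mem_ofPred_eq, ← Function.iterate_succ_apply,
      Function.iterate_succ_apply', T.1.injective.eq_iff]
  rw [← QuotientGroup.mk_pow, MPAut.mk_eq_one_iff, MPAut.coe_pow]
  rcases hT.ae_mem_or_ae_notMem hm hinv with h | h
  · exact h
  · refine absurd (measure_mono_null ?_ (ae_iff.1 h)) hx₀
    rintro z rfl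
    simpa using hy

namespace TowerPartition

/-- An invariant set `A` occupies the same proportion of each level. Approximating it by a union of
levels costs, in each level, at least the smaller of the measures of `A` and `Aᶜ` there. -/
theorem min_le_of_preimage_eq [IsProbabilityMeasure μ] {ξ : TowerPartition T.1} {A E : Set X}
    (hA : MeasurableSet A) (hinv : T.1 ⁻¹' A = A) (hE : ξ.Saturated E) :
    min (μ.real A) (μ.real Aᶜ) ≤ μ.real (E ∆ A) + (1 - μ.real ξ.tower) := by
  have hlevel : ∀ (W : Set X), MeasurableSet W → T.1 ⁻¹' W = W → ∀ k,
      μ.real (W ∩ ξ.level k) = μ.real (W ∩ ξ.base) := by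
    intro W hW hWinv k
    have hWk : (T ^ k).1 ⁻¹' W = W := by
      rw [MPAut.coe_pow]
      exact Function.IsFixedPt.preimage_iterate hWinv k
    rw [← MPAut.measureReal_preimage (T ^ k) (hW.inter (ξ.measurableSet_level k)),
      Set.preimage_inter, hWk, level_eq_preimage]
    congr 2
    ext x
    have : ((T ^ k)⁻¹).1 ((T ^ k).1 x) = x := (T ^ k).1.symm_apply_apply x
    rw [Set.mem_preimage, Set.mem_preimage, this]
  have hle : ∀ (W : Set X), MeasurableSet W → T.1 ⁻¹' W = W →
      μ.real W ≤ ξ.height * μ.real (W ∩ ξ.base) + (1 - μ.real ξ.tower) := by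
    intro W hW hWinv
    have h1 : W ⊆ (⋃ k ∈ Finset.range ξ.height, W ∩ ξ.level k) ∪ ξ.towerᶜ := by
      intro x hx
      by_cases hxt : x ∈ ξ.tower
      · obtain ⟨k, hk, hxk⟩ := mem_tower.1 hxt
        exact Or.inl (Set.mem_biUnion (Finset.mem_coe.2 (Finset.mem_range.2 hk)) ⟨hx, hxk⟩)
      · exact Or.inr hxt
    refine (measureReal_mono h1).trans ((measureReal_union_le _ _).trans (add_le_add ?_ ?_))
    · refine (measureReal_biUnion_finset_le _ _).trans (le_of_eq ?_)
      rw [Finset.sum_congr rfl fun k _ => hlevel W hW hWinv k, Finset.sum_const,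
        Finset.card_range, nsmul_eq_mul]
    · rw [probReal_compl_eq_one_sub ξ.measurableSet_tower]
  have hinv' : T.1 ⁻¹' Aᶜ = Aᶜ := by rw [Set.preimage_compl, hinv]
  have hEA := hE.measurableSet.symmDiff hA
  have hmin : ∀ k ∈ Finset.range ξ.height,
      min (μ.real (A ∩ ξ.base)) (μ.real (Aᶜ ∩ ξ.base)) ≤ μ.real ((E ∆ A) ∩ ξ.level k) := by
    intro k hk
    by_cases hx : ∃ x ∈ ξ.level k, x ∈ E
    · obtain ⟨x, hxk, hxE⟩ := hx
      refine (min_le_right _ _).trans ?_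
      rw [← hlevel Aᶜ hA.compl hinv' k]
      refine measureReal_mono fun y hy => ⟨Or.inl ⟨?_, hy.1⟩, hy.2⟩
      exact (hE.mem_iff (Finset.mem_range.1 hk) hxk hy.2).1 hxE
    · refine (min_le_left _ _).trans ?_
      rw [← hlevel A hA hinv k]
      exact measureReal_mono fun y hy => ⟨Or.inr ⟨hy.1, fun h => hx ⟨y, hy.2, h⟩⟩, hy.2⟩
  have hsum : ξ.height * min (μ.real (A ∩ ξ.base)) (μ.real (Aᶜ ∩ ξ.base)) ≤ μ.real (E ∆ A) := by
    calc _ = ∑ k ∈ Finset.range ξ.height,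
          min (μ.real (A ∩ ξ.base)) (μ.real (Aᶜ ∩ ξ.base)) := by
          rw [Finset.sum_const, Finset.card_range, nsmul_eq_mul]
      _ ≤ ∑ k ∈ Finset.range ξ.height, μ.real ((E ∆ A) ∩ ξ.level k) := Finset.sum_le_sum hmin
      _ = μ.real (⋃ k ∈ Finset.range ξ.height, (E ∆ A) ∩ ξ.level k) := by
          refine (measureReal_biUnion_finset (fun i hi j hj hij => ?_)
            (fun k _ => hEA.inter (ξ.measurableSet_level k))).symm
          exact (ξ.level_disjoint (by simpa using hi) (by simpa using hj) hij).mono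
            Set.inter_subset_right Set.inter_subset_right
      _ ≤ _ := measureReal_mono (Set.iUnion₂_subset fun k _ => Set.inter_subset_left)
  have h1 := hle A hA hinv
  have h2 := hle Aᶜ hA.compl hinv'
  rcases le_total (μ.real (A ∩ ξ.base)) (μ.real (Aᶜ ∩ ξ.base)) with h | h
  · rw [min_eq_left h] at hsum
    exact (min_le_left _ _).trans (by linarith)
  · rw [min_eq_right h] at hsum
    exact (min_le_right _ _).trans (by linarith)

end TowerPartition

theorem RankOne.ergodic [IsProbabilityMeasure μ] (hT : RankOne μ T.1) : Ergodic T.1 μ := by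
  obtain ⟨ξ, hξ, htower⟩ := HasTowers.exists_approximates hT.1
  refine ⟨MPAut.measurePreserving T, ⟨fun A hA hinv => ?_⟩⟩
  obtain ⟨E, hE, hElim⟩ := hξ A hA
  have hlim : Tendsto (fun j => μ.real (E j ∆ A) + (1 - μ.real (ξ j).tower)) atTop (𝓝 0) := by
    simpa using hElim.add (htower.const_sub 1)
  have hmin : min (μ.real A) (μ.real Aᶜ) ≤ 0 := ge_of_tendsto' hlim fun j =>
    TowerPartition.min_le_of_preimage_eq hA hinv (hE j)
  rw [eventuallyConst_set', ae_eq_empty, ae_eq_univ]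
  rcases min_le_iff.1 hmin with h | h
  · exact Or.inl ((measureReal_eq_zero_iff).1 (le_antisymm h measureReal_nonneg))
  · exact Or.inr ((measureReal_eq_zero_iff).1 (le_antisymm h measureReal_nonneg))

theorem HasTowers.le_one [IsProbabilityMeasure μ] {β : ℝ} (h : HasTowers μ T.1 β) : β ≤ 1 := by
  obtain ⟨ξ, -, htower⟩ := h.exists_approximates
  exact le_of_tendsto' htower fun j => measureReal_le_one

theorem exists_measure_ne_zero_disjoint_preimage [MeasurableSpace.CountablySeparated X]
    {S : MPAut μ} (hS : (S : AutGroup μ) ≠ 1) :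
    ∃ C : Set X, MeasurableSet C ∧ μ (C ∩ S.1 ⁻¹' Cᶜ) ≠ 0 := by
  have h : μ {x | S.1 x ≠ x} ≠ 0 := fun h => hS ((MPAut.mk_eq_one_iff S).2 (ae_iff.2 h))
  obtain ⟨C, hC, hC0⟩ := exists_measure_separated_ne_zero (a := _root_.id) (b := S.1) h
    fun y hy => Ne.symm hy
  exact ⟨C, hC, fun h0 => hC0 (measure_mono_null Set.inter_subset_right h0)⟩

theorem isPartiallyRigid_of_mem_weakHomoclinic [StandardBorelSpace X] [IsProbabilityMeasure μ]
    (hT : Ergodic T.1 μ) {β : ℝ} (htow : HasTowers μ T.1 β) {S : AutGroup μ}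
    (hS : S ∈ weakHomoclinic (T : AutGroup μ)) (hS1 : S ≠ 1) :
    IsPartiallyRigid (T : AutGroup μ) β := by
  classical
  obtain ⟨S, rfl⟩ := QuotientGroup.mk_surjective S
  have hβ : 0 < β := htow.1
  by_cases hper : ∃ r, 0 < r ∧ (T : AutGroup μ) ^ r = 1
  · obtain ⟨r, hr, h⟩ := hper
    exact isPartiallyRigid_of_pow_eq_one hr h β
  have hatom : ∀ x, μ {x} = 0 := by
    intro x
    by_contra hx
    exact hper (hT.exists_pow_eq_one_of_atom hx)
  have hstat := statAsymptotic_of_mem_weakHomoclinic hS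
  have hS0 : μ {x | S.1 x ≠ x} ≠ 0 := fun h => hS1 ((MPAut.mk_eq_one_iff S).2 (ae_iff.2 h))
  -- sets that are disjoint from their first images, to exclude small shifts
  have hdisj : ∀ r : ℕ, ∃ A : Set X, MeasurableSet A ∧ 0 < μ.real A ∧
      (T ^ (r + 1)).1 ⁻¹' A ∩ A = ∅ := by
    intro r
    have hr : ((T ^ (r + 1) : MPAut μ) : AutGroup μ) ≠ 1 := fun h =>
      hper ⟨r + 1, r.succ_pos, by rw [← QuotientGroup.mk_pow, h]⟩
    obtain ⟨C, hC, hC0⟩ := exists_measure_ne_zero_disjoint_preimage hr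
    refine ⟨_, hC.inter (MPAut.measurable (T ^ (r + 1)) hC.compl), ?_, ?_⟩
    · exact lt_of_le_of_ne measureReal_nonneg fun h => hC0 ((measureReal_eq_zero_iff).1 h.symm)
    · refine Set.eq_empty_of_forall_notMem fun x hx => hx.2.2 hx.1.1
  choose A hA hApos hAdisj using hdisj
  refine isPartiallyRigid_of_shifts htow.le_one fun 𝒜 k => ?_
  obtain ⟨ε, hε, hεk, hεA⟩ : ∃ ε : ℝ, 0 < ε ∧ ε < 1 / ((k : ℝ) + 1) ∧
      ∀ r ∈ Finset.range k, ε < β * μ.real (A r) := by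
    have hev : ∀ c : ℝ, 0 < c → ∀ᶠ ε in 𝓝[>] (0 : ℝ), ε < c := fun c hc =>
      nhdsWithin_le_nhds (gt_mem_nhds hc)
    have hev2 : ∀ᶠ ε in 𝓝[>] (0 : ℝ), ∀ r ∈ Finset.range k, ε < β * μ.real (A r) := by
      rw [Filter.eventually_all_finset]
      exact fun r _ => hev _ (mul_pos hβ (hApos r))
    exact (eventually_mem_nhdsWithin.and ((hev _ (by positivity)).and hev2)).exists
  obtain ⟨m, hm, hshift⟩ := exists_shift_of_statAsymptotic hT hatom hβ htow hstat hS0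
    (𝒜.image Subtype.val ∪ (Finset.range k).image A) (fun W hW => by
      rcases Finset.mem_union.1 hW with h | h
      · obtain ⟨V, -, rfl⟩ := Finset.mem_image.1 h
        exact V.2
      · obtain ⟨r, -, rfl⟩ := Finset.mem_image.1 h
        exact hA r) hε
  refine ⟨m, ?_, fun V hV W hW => ?_⟩
  · by_contra! hlt
    have hmem : m - 1 ∈ Finset.range k := Finset.mem_range.2 (by omega)
    have hA' : A (m - 1) ∈ 𝒜.image Subtype.val ∪ (Finset.range k).image A :=
      Finset.mem_union_right _ (Finset.mem_image_of_mem A hmem)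
    have h1 := hshift _ hA' _ hA'
    have h2 := hAdisj (m - 1)
    rw [Nat.sub_add_cancel hm] at h2
    rw [h2, Set.inter_self, measureReal_empty] at h1
    linarith [hεA _ hmem]
  · have h1 := hshift V.1 (Finset.mem_union_left _ (Finset.mem_image_of_mem _ hV)) W.1
      (Finset.mem_union_left _ (Finset.mem_image_of_mem _ hW))
    linarith

theorem one_mem_homoclinic (T : AutGroup μ) : 1 ∈ homoclinic T := by
  intro f
  simp only [mul_one, inv_mul_cancel, map_one, one_apply_eq_self]
  exact tendsto_const_nhds

theorem homoclinic_subset_weakHomoclinic (T : AutGroup μ) :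
    homoclinic T ⊆ weakHomoclinic T := by
  intro S hS f
  simp only [sum_Icc_one]
  exact ((hS f).comp (tendsto_add_atTop_nat 1)).cesaro_smul

/-- A mixing transformation is rigid only on a trivial space: `μ A = μ A ^ 2` for all `A`. -/
theorem IsRigid.eq_one_of_isMixing [MeasurableSpace.CountablySeparated X] [IsProbabilityMeasure μ]
    (hrig : IsRigid (T : AutGroup μ)) (hmix : IsMixing μ T.1) (S : AutGroup μ) : S = 1 := by
  obtain ⟨S, rfl⟩ := QuotientGroup.mk_surjective S
  by_contra hS
  obtain ⟨C, hC, hC0⟩ := exists_measure_ne_zero_disjoint_preimage hS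
  obtain ⟨n, hn, hlim⟩ := hrig
  have h1 := (hlim (indL2 μ hC)).inner (𝕜 := ℝ) (tendsto_const_nhds (x := indL2 μ hC))
  rw [inner_indL2, Set.inter_self] at h1
  have h2 : Tendsto (fun i => μ.real (T.1^[n i] ⁻¹' C ∩ C)) atTop (𝓝 (μ.real C * μ.real C)) := by
    have := (ENNReal.tendsto_toReal (ENNReal.mul_ne_top (measure_ne_top μ C)
      (measure_ne_top μ C))).comp ((hmix C C hC hC).comp hn)
    rwa [ENNReal.toReal_mul] at this
  have h3 : μ.real C = μ.real C * μ.real C := by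
    refine tendsto_nhds_unique h1 (h2.congr fun i => ?_)
    rw [← QuotientGroup.mk_pow, koopman_indL2, inner_indL2, ← MPAut.coe_pow]
    have hm := MPAut.measurable (T ^ n i)⁻¹ hC
    rw [← MPAut.measureReal_preimage (T ^ n i) (hm.inter hC), Set.preimage_inter, Set.inter_comm]
    congr 2
    ext x
    have : ((T ^ n i)⁻¹).1 ((T ^ n i).1 x) = x := (T ^ n i).1.symm_apply_apply x
    rw [Set.mem_preimage, Set.mem_preimage, this]
  have h4 : μ.real C ≠ 0 := fun h => hC0 (measure_mono_null Set.inter_subset_left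
    ((measureReal_eq_zero_iff).1 h))
  have h5 : μ.real Cᶜ ≠ 0 := by
    intro h
    rw [← MPAut.measureReal_preimage S hC.compl] at h
    exact hC0 (measure_mono_null Set.inter_subset_right ((measureReal_eq_zero_iff).1 h))
  rw [probReal_compl_eq_one_sub hC, sub_ne_zero] at h5
  exact h5 (mul_left_cancel₀ h4 (by rw [mul_one]; exact h3))

end

theorem theorem3 {X : Type*} [MeasurableSpace X] [StandardBorelSpace X]
    (μ : Measure X) [IsProbabilityMeasure μ] :
    (∀ T : MPAut μ, RankOne μ (T : Equiv.Perm X) →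
      (weakHomoclinic (T : AutGroup μ)).Infinite → IsRigid (T : AutGroup μ)) ∧
    (∀ R : MPAut μ, IsMixing μ (R : Equiv.Perm X) → RankOne μ (R : Equiv.Perm X) →
      homoclinic (R : AutGroup μ) = {1} ∧ weakHomoclinic (R : AutGroup μ) = {1}) ∧
    (∀ (T : MPAut μ) (β : ℝ), Ergodic (T : Equiv.Perm X) μ → 0 < β →
      HasLocalRank μ (T : Equiv.Perm X) β →
      (weakHomoclinic (T : AutGroup μ)).Infinite → IsPartiallyRigid (T : AutGroup μ) β) := by
  refine ⟨fun T hT hinf => ?_, fun R hmix hR => ?_, fun T β hT _ hrank hinf => ?_⟩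
  · obtain ⟨S, hS, hS1⟩ := hinf.exists_notMem_finset {1}
    exact (isPartiallyRigid_of_mem_weakHomoclinic hT.ergodic hT.1 hS (by simpa using hS1)).isRigid
  · have hsub : ∀ S ∈ weakHomoclinic (R : AutGroup μ), S = 1 := by
      intro S hS
      by_contra hS1
      exact hS1 ((isPartiallyRigid_of_mem_weakHomoclinic hR.ergodic hR.1 hS
        hS1).isRigid.eq_one_of_isMixing hmix S)
    have hone := one_mem_homoclinic (R : AutGroup μ)
    have hHW := homoclinic_subset_weakHomoclinic (R : AutGroup μ)
    exact ⟨Set.eq_singleton_iff_unique_mem.2 ⟨hone, fun S hS => hsub S (hHW hS)⟩,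
      Set.eq_singleton_iff_unique_mem.2 ⟨hHW hone, hsub⟩⟩
  · obtain ⟨S, hS, hS1⟩ := hinf.exists_notMem_finset {1}
    exact isPartiallyRigid_of_mem_weakHomoclinic hT hrank.1 hS (by simpa using hS1)
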